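/- Let $K$ be a number field, $p$ an odd prime, and $\mathfrak p$ a prime of $K$ above $p$. Let $E$ be an elliptic curve over $K$ given by a Weierstrass equation $$y^2+a_1xy+a_3y=x^3+a_2x^2+a_4x+a_6$$ that is minimal at $\mathfrak p$, and suppose that $E$ has good supersingular reduction at $\mathfrak p$ (the reduced curve is an elliptic curve with no nonzero $p$-torsion point over an algebraic closure of the residue field). Let $\overline{K_{\mathfrak p}}$ be an algebraic closure of the completion of $K$ at $\mathfrak p$, and let $v$ be the extension to $\overline{K_{\mathfrak p}}$ of the $\mathfrak p$-adic valuation, normalized by $v(p)=1$, with $v(0)=\infty$. Let $\hat E$ be the formal group of $E$, with values in the maximal ideal of the ring of integers of $\overline{K_{\mathfrak p}}$. The map $Q\mapsto \hat Q:=-x(Q)/y(Q)$, $O\mapsto 0$, identifies the kernel of reduction, which consists of $O$ and of the points $Q\in E(\overline{K_{\mathfrak p}})$ with $v(x(Q))<0$, with $\hat E$; in particular $[k]\hat Q=\widehat{[k]Q}$. If there are $R,Q$ of exact order $p$ in the kernel of reduction with $v(\hat R)>v(\hat Q)$, the subgroup $\langle R\rangle$ is called the canonical subgroup of $E$ at $\mathfrak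 p$ and denoted $C_{\mathrm{can}}$; if there are no such $R,Q$, we say that there is no canonical subgroup. Let $\mu\in(-\infty,\infty]$ be the valuation of the coefficient of $x^{(p^2-p)/2}$ in the $p$-th division polynomial $\Psi_p(x)$ of the given equation. Let $n\ge 1$ and let $P\in E(\overline{K_{\mathfrak p}})$ be a point of exact order $p^n$. Then $P$ lies in the kernel of reduction, and the following hold. 1. If $\mu\ge \frac{p}{p+1}$, then there is no canonical subgroup, and $$v(\hat P)=\frac{1}{p^{2n}-p^{2n-2}}.$$ 2. Otherwise $0<\mu<\frac{p}{p+1}$, there is a canonical subgroup, and it is unique. (a) If $[p^{n-1}]P\notin C_{\mathrm{can}}$, then $\displaystyle v(\hat P)=\frac{\mu}{p^{2n-2}(p^2-p)}$. (b) If $[p^{n-1}]P\in C_{\mathrm{can}}$ and $n=1$, then $\displaystyle v(\hat P)=\frac{1-\mu}{p-1}$. (c) Suppose that $[p^{n-1}]P\in C_{\mathrm{can}}$ and $n>1$. If there is an integer $m\ge 0$ with $v([p^m]\hat P)=\frac{\mu}{p^2-p}$, then for the smallest such $m$ $$v(\hat P)=\frac{\mu}{p^{2m}(p^2-p)}.$$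 If there is no such integer, let $s\ge 0$ be the smallest integer with $\mu\ge \frac{1}{p^s(p+1)}$ (it exists). - If $n>s+1$, then $\displaystyle v(\hat P)=\frac{1-p^s\mu}{p^{2n-s-2}(p-1)}$. - If $n\le s+1$, then $\displaystyle v(\hat P)=\frac{1-p^{n-1}\mu}{p^{n-1}(p-1)}$. Moreover, in this case, writing $\hat Q:=[p]\hat P$, exactly $p$ elements of the fibre $[p]^{-1}\hat Q\subset\hat E$ have valuation $\frac{1-p^{n-1}\mu}{p^{n-1}(p-1)}$, and exactly $p^2-p$ elements of it have valuation $\frac{\mu}{p^2-p}$. -/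

import Mathlib

open IsDedekindDomain NumberField
open scoped Classical

namespace FormalTorsion

noncomputable section

/-- A Weierstrass curve over a field `k` is `p`-supersingular if it is an elliptic curve without
nonzero `p`-torsion points over an algebraic closure of `k`. It is used for `char k = p`. -/
def IsSupersingular {k : Type*} [Field k] (p : ℕ) (W : WeierstrassCurve k) : Prop :=
  W.IsElliptic ∧
    ∀ P : (W.baseChange (AlgebraicClosure k)).toAffine.Point, p • P = 0 → P = 0

variable {K : Type*} [Field K] [NumberField K]

/-- The Weierstrass equation `E` over `K`, viewed over the completion `K_𝔭`, is a minimal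
equation with good reduction, and its reduction is supersingular. -/
def HasGoodSupersingularReduction (p : ℕ) (𝔭 : HeightOneSpectrum (𝓞 K))
    (E : WeierstrassCurve K) : Prop :=
  ∃ _ : (E.baseChange (𝔭.adicCompletion K)).HasGoodReduction (𝔭.adicCompletionIntegers K),
    IsSupersingular p
      ((E.baseChange (𝔭.adicCompletion K)).reduction (𝔭.adicCompletionIntegers K))

/-- An algebraic closure of the completion `K_𝔭`. -/
abbrev LocalClosure (𝔭 : HeightOneSpectrum (𝓞 K)) : Type _ :=
  AlgebraicClosure (𝔭.adicCompletion K)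

/-- The additive valuation on the algebraic closure of `K_𝔭` that extends the `𝔭`-adic one,
normalized by `v p = 1` (for `𝔭` above `p`), with `v 0 = ⊤`. The spectral norm is the unique
extension to the algebraic closure of the absolute value of `K_𝔭`. -/
def val (p : ℕ) (𝔭 : HeightOneSpectrum (𝓞 K)) (x : LocalClosure 𝔭) : WithTop ℝ :=
  if x = 0 then ⊤
  else ((Real.log (spectralNorm (𝔭.adicCompletion K) (LocalClosure 𝔭) x) /
    Real.log (spectralNorm (𝔭.adicCompletion K) (LocalClosure 𝔭) (p : LocalClosure 𝔭)) : ℝ) :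
      WithTop ℝ)

/-- The group of points of `E` over the algebraic closure of `K_𝔭`. -/
abbrev GeomPoint (𝔭 : HeightOneSpectrum (𝓞 K)) (E : WeierstrassCurve K) : Type _ :=
  (E.baseChange (LocalClosure 𝔭)).toAffine.Point

/-- The kernel of reduction: the point at infinity and the affine points whose `x`-coordinate
is not integral. The map `P ↦ -x(P)/y(P)` identifies it with the formal group of `E` on the
maximal ideal of the ring of integers of the algebraic closure of `K_𝔭`. -/
def kernelOfReduction (p : ℕ) (𝔭 : HeightOneSpectrum (𝓞 K)) (E : WeierstrassCurve K) :
    Set (GeomPoint 𝔭 E)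
  | .zero => True
  | .some x _ _ => val p 𝔭 x < 0

/-- The formal group parameter `-x(P)/y(P)` of a point `P`, equal to `0` at infinity. -/
def formalParam (𝔭 : HeightOneSpectrum (𝓞 K)) (E : WeierstrassCurve K) :
    GeomPoint 𝔭 E → LocalClosure 𝔭
  | .zero => 0
  | .some x y _ => -x / y

/-- The valuation of the image of a point in the formal group. -/
def formalVal (p : ℕ) (𝔭 : HeightOneSpectrum (𝓞 K)) (E : WeierstrassCurve K)
    (P : GeomPoint 𝔭 E) : WithTop ℝ :=
  val p 𝔭 (formalParam 𝔭 E P)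

/-- `C` is the canonical subgroup of `E` at `𝔭`: it is generated by a point `R` of exact order
`p` in the kernel of reduction whose formal group valuation exceeds that of some other such
point `Q`. -/
def IsCanonicalSubgroup (p : ℕ) (𝔭 : HeightOneSpectrum (𝓞 K)) (E : WeierstrassCurve K)
    (C : AddSubgroup (GeomPoint 𝔭 E)) : Prop :=
  ∃ R Q : GeomPoint 𝔭 E,
    R ∈ kernelOfReduction p 𝔭 E ∧ addOrderOf R = p ∧
    Q ∈ kernelOfReduction p 𝔭 E ∧ addOrderOf Q = p ∧
    formalVal p 𝔭 E Q < formalVal p 𝔭 E R ∧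
    C = AddSubgroup.zmultiples R

/-- For odd `p` the bivariate polynomial `Ψ_p` is the univariate polynomial `preΨ p` in `x`. -/
theorem divisionPolynomial_odd {R : Type*} [CommRing R] (W : WeierstrassCurve R) {p : ℕ}
    (hp : Odd p) : W.Ψ (p : ℤ) = Polynomial.C (W.preΨ (p : ℤ)) := by
  have h : ¬ Even (p : ℤ) := by
    rw [Int.not_even_iff_odd]
    exact_mod_cast hp
  simp [WeierstrassCurve.Ψ, Nat.not_even_iff_odd.mpr hp]

/-- For odd `p`, the valuation `μ` of the coefficient of `x ^ ((p ^ 2 - p) / 2)` in the `p`-th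
division polynomial `Ψ_p` of `E`. -/
def mu (p : ℕ) (𝔭 : HeightOneSpectrum (𝓞 K)) (E : WeierstrassCurve K) : WithTop ℝ :=
  val p 𝔭 (algebraMap K (LocalClosure 𝔭) ((E.preΨ (p : ℤ)).coeff ((p ^ 2 - p) / 2)))

end

end FormalTorsion

/-! The theorem is proved on the group of points and with division polynomials; no power series of
the formal group is needed. For a point with |x| > 1 the equation forces |y|^2 = |x|^3, so v(-x/y) =
-v(x)/2, and everything concerns the function h(P) = -v(x(P))/2 on p-primary torsion.

Supersingularity says that ψ_p reduces to a nonzero constant. Hence p-primary torsion lies in the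
kernel of reduction (`one_lt_norm_xCoord`). The addition formulas for x(P+Q) and x(P-Q) make h
ultrametric (`norm_add_ge`). Combined with x(pP) = Φ_p(x)/ψ_p(x)^2 and the factorization of ψ_p over
the torsion, they give two sum rules: the values h(T) over nonzero p-torsion T add up to 1
(`sum_pointVal`), and h(pP) is the sum of h over the fibre of [p] through P (`norm_xCoord_smul`).
These facts are the axioms of `TorsionNorm`.

From there the argument is combinatorial. Among the p^2 - 1 nonzero p-torsion points, either h is
constant, or it takes a value α on the nonzero elements of a subgroup of order p and a smaller value
β elsewhere (`constant_or_hasBreak`). In a fibre of [p], a point P₀ of maximal h satisfies h(P₀+T) =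
min(h(P₀), h(T)), so h(pP) is a piecewise linear increasing function of h(P₀). Inverting it
(`HasBreak.fibre`) and iterating yields all the formulas.

Finally, μ detects which case occurs. The coefficient is ±p times the elementary symmetric function
of degree (p-1)/2 in the x-coordinates of the p-torsion. With a canonical subgroup, one monomial
dominates and μ = 1 - (p-1)α = (p^2-p)β < p/(p+1); otherwise every monomial gives the bound μ ≥
p/(p+1).

The input on division polynomials (the multiplication formula, and the count of p-torsion in
characteristic zero) is itself derived from the elliptic net relation. -/

section EllipticNet

/-! ### Elliptic divisibility sequences: the two-index relation. -/

/-- The Plücker relation for four vectors in the plane. -/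
lemma plucker_relation {R : Type*} [CommRing R] {K u₁ u₂ u₃ u₄ v₁ v₂ v₃ v₄ : R}
    {A₁₂ A₃₄ A₁₃ A₂₄ A₁₄ A₂₃ : R}
    (h₁₂ : A₁₂ * K = u₁ * v₂ - u₂ * v₁) (h₃₄ : A₃₄ * K = u₃ * v₄ - u₄ * v₃)
    (h₁₃ : A₁₃ * K = u₁ * v₃ - u₃ * v₁) (h₂₄ : A₂₄ * K = u₂ * v₄ - u₄ * v₂)
    (h₁₄ : A₁₄ * K = u₁ * v₄ - u₄ * v₁) (h₂₃ : A₂₃ * K = u₂ * v₃ - u₃ * v₂) :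
    K ^ 2 * (A₁₂ * A₃₄ - A₁₃ * A₂₄ + A₁₄ * A₂₃) = 0 := by
  linear_combination A₃₄ * K * h₁₂ + (u₁ * v₂ - u₂ * v₁) * h₃₄ - A₂₄ * K * h₁₃ -
    (u₁ * v₃ - u₃ * v₁) * h₂₄ + A₂₃ * K * h₁₄ + (u₁ * v₄ - u₄ * v₁) * h₂₃

/-- The elliptic relation with base pair `(1, 0)`. -/
def EvenNetRel {R : Type*} [CommRing R] (W : ℤ → R) (a b : ℤ) : Prop :=
  W (a + b) * W (a - b) = W (a + 1) * W (a - 1) * W b ^ 2 - W (b + 1) * W (b - 1) * W a ^ 2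

/-- The elliptic relation with base pair `(3 / 2, 1 / 2)`. -/
def OddNetRel {R : Type*} [CommRing R] (W : ℤ → R) (a b : ℤ) : Prop :=
  W (a + b + 1) * W (a - b) * W 2 =
    W (a + 2) * W (a - 1) * (W (b + 1) * W b) - W (b + 2) * W (b - 1) * (W (a + 1) * W a)

variable {R : Type*} [CommRing R] {W : ℤ → R}

lemma EvenNetRel.symm (hW : ∀ n, W (-n) = -W n) {a b : ℤ} (h : EvenNetRel W a b) :
    EvenNetRel W b a := by
  unfold EvenNetRel at *
  have := hW (a - b)
  rw [neg_sub] at this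
  rw [this, add_comm b a]
  linear_combination -h

lemma OddNetRel.symm (hW : ∀ n, W (-n) = -W n) {a b : ℤ} (h : OddNetRel W a b) :
    OddNetRel W b a := by
  unfold OddNetRel at *
  have := hW (a - b)
  rw [neg_sub] at this
  rw [this, add_comm b a]
  linear_combination -h

/-- The relation for a base pair says that W(x+y)W(x-y) is, up to a constant factor, the determinant
of plane vectors attached to x and y. Plücker then gives a relation among any four indices. Integer
and half-integer indices are treated together by induction on the sum of the two indices, since each
kind is needed for the other; the defining recursions are the cases of nearly equal indices. -/
lemma netRel_aux [IsDomain R] (hW : ∀ n, W (-n) = -W n) (h0 : W 0 = 0) (h1 : W 1 = 1)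
    (h2 : W 2 ≠ 0)
    (hodd : ∀ m, W (2 * m + 1) = W (m + 2) * W m ^ 3 - W (m - 1) * W (m + 1) ^ 3)
    (heven : ∀ m, W (2 * m) * W 2 =
      W (m - 1) ^ 2 * W m * W (m + 2) - W (m - 2) * W m * W (m + 1) ^ 2) (n : ℕ) :
    (∀ a b : ℤ, 0 ≤ a → 0 ≤ b → a + b ≤ n → EvenNetRel W a b) ∧
    (∀ a b : ℤ, 0 ≤ a → 0 ≤ b → a + b + 1 ≤ n → OddNetRel W a b) := by
  have hm1 : W (-1) = -1 := by rw [hW, h1]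
  have E1 : ∀ b, EvenNetRel W (b + 1) b := fun b ↦ by
    unfold EvenNetRel
    rw [show b + 1 + b = 2 * b + 1 by ring, hodd]
    ring_nf
    rw [h1]; ring
  have O1 : ∀ b, OddNetRel W (b + 1) b := fun b ↦ by
    unfold OddNetRel
    have := heven (b + 1)
    rw [show b + 1 + b + 1 = 2 * (b + 1) by ring, show b + 1 - b = 1 by ring, h1, mul_one, this]
    ring_nf
  have E2 : ∀ b, EvenNetRel W (b + 2) b := fun b ↦ by
    unfold EvenNetRel
    have := heven (b + 1)
    rw [show b + 2 + b = 2 * (b + 1) by ring, show b + 2 - b = 2 by ring, this]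
    ring_nf
  have Ed : ∀ b, EvenNetRel W b b := fun b ↦ by
    unfold EvenNetRel; rw [sub_self, h0]; ring
  have Od : ∀ b, OddNetRel W b b := fun b ↦ by
    unfold OddNetRel; rw [sub_self, h0]; ring
  have Ez : ∀ a, EvenNetRel W a 0 := fun a ↦ by
    unfold EvenNetRel; simp only [add_zero, sub_zero, zero_add, zero_sub, h0, h1, hm1]; ring
  have Eo : ∀ a, EvenNetRel W a 1 := fun a ↦ by
    unfold EvenNetRel; simp only [sub_self, h0, h1]; ring
  have Oz : ∀ a, OddNetRel W a 0 := fun a ↦ by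
    unfold OddNetRel; simp only [add_zero, sub_zero, zero_add, zero_sub, h0, h1, hm1]; ring
  have Oo : ∀ a, OddNetRel W a 1 := fun a ↦ by
    unfold OddNetRel
    simp only [sub_self, h0, h1, show a + 1 + 1 = a + 2 by ring, show (1 : ℤ) + 1 = 2 by norm_num]
    ring
  induction n with
  | zero =>
    refine ⟨fun a b ha hb h ↦ ?_, fun a b ha hb h ↦ ?_⟩
    · obtain rfl : a = b := by push_cast at h; omega
      exact Ed a
    · push_cast at h; omega
  | succ n ih =>
    obtain ⟨ihE, ihO⟩ := ih
    have keyE : ∀ a b : ℤ, b ≤ a → 0 ≤ b → a + b ≤ n + 1 → EvenNetRel W a b := by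
      intro a b hab hb h
      obtain rfl | rfl | hb2 : b = 0 ∨ b = 1 ∨ 2 ≤ b := by omega
      · exact Ez a
      · exact Eo a
      obtain rfl | rfl | rfl | hab3 : a = b ∨ a = b + 1 ∨ a = b + 2 ∨ b + 3 ≤ a := by omega
      · exact Ed _
      · exact E1 _
      · exact E2 _
      -- With a + b = 2s and a - b = 2d, Plücker at the half-integers s ± 1/2, d ± 1/2 has leading
      -- product W(2s)W(2d) = W(a+b)W(a-b). For odd a + b the indices s+1, s, d, d-1 play this role.
      -- The other pairs have smaller sum because b ≥ 2.
      obtain ⟨s, hs⟩ | ⟨s, hs⟩ := Int.even_or_odd (a + b)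
      · obtain ⟨d, rfl⟩ : ∃ d, a = s + d := ⟨a - s, by ring⟩
        obtain rfl : b = s - d := by linarith
        have p12 := O1 (s - 1)
        have p34 := O1 (d - 1)
        have p13 := ihO s d (by omega) (by omega) (by omega)
        have p24 := ihO (s - 1) (d - 1) (by omega) (by omega) (by omega)
        have p14 := ihO s (d - 1) (by omega) (by omega) (by omega)
        have p23 := ihO (s - 1) d (by omega) (by omega) (by omega)
        rw [sub_add_cancel] at p12 p34
        have := (mul_eq_zero.mp (plucker_relation p12 p34 p13 p24 p14 p23)).resolve_left
          (pow_ne_zero _ h2)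
        unfold EvenNetRel
        ring_nf at this ⊢
        rw [h1] at this
        linear_combination this
      · obtain ⟨d, rfl⟩ : ∃ d, a = s + d := ⟨a - s, by ring⟩
        obtain rfl : b = s + 1 - d := by linarith
        have p12 := E1 s
        have p34 := E1 (d - 1)
        have p13 := ihE (s + 1) d (by omega) (by omega) (by omega)
        have p24 := ihE s (d - 1) (by omega) (by omega) (by omega)
        have p14 := ihE (s + 1) (d - 1) (by omega) (by omega) (by omega)
        have p23 := ihE s d (by omega) (by omega) (by omega)
        rw [sub_add_cancel] at p34
        have q : ∀ {x y : R}, x = y → x * 1 = y := fun h ↦ by rw [mul_one, h]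
        have := (mul_eq_zero.mp (plucker_relation (q p12) (q p34) (q p13) (q p24) (q p14)
          (q p23))).resolve_left (pow_ne_zero _ one_ne_zero)
        unfold EvenNetRel
        ring_nf at this ⊢
        rw [h1] at this
        linear_combination this
    have keyO : ∀ a b : ℤ, b ≤ a → 0 ≤ b → a + b + 1 ≤ n + 1 → OddNetRel W a b := by
      intro a b hab hb h
      obtain rfl | rfl | hb2 : b = 0 ∨ b = 1 ∨ 2 ≤ b := by omega
      · exact Oz a
      · exact Oo a
      obtain rfl | rfl | hab3 : a = b ∨ a = b + 1 ∨ b + 2 ≤ a := by omega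
      · exact Od _
      · exact O1 _
      obtain ⟨s, hs⟩ | ⟨s, hs⟩ := Int.even_or_odd (a + b)
      · obtain ⟨d, rfl⟩ : ∃ d, a = s + d := ⟨a - s, by ring⟩
        obtain rfl : b = s - d := by linarith
        have p12 := E1 s
        have p34 := E2 (d - 1)
        have p13 := ihE (s + 1) (d + 1) (by omega) (by omega) (by omega)
        have p24 := ihE s (d - 1) (by omega) (by omega) (by omega)
        have p14 := ihE (s + 1) (d - 1) (by omega) (by omega) (by omega)
        have p23 := ihE s (d + 1) (by omega) (by omega) (by omega)
        rw [show d - 1 + 2 = d + 1 by ring] at p34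
        have q : ∀ {x y : R}, x = y → x * 1 = y := fun h ↦ by rw [mul_one, h]
        have := (mul_eq_zero.mp (plucker_relation (q p12) (q p34) (q p13) (q p24) (q p14)
          (q p23))).resolve_left (pow_ne_zero _ one_ne_zero)
        unfold OddNetRel
        ring_nf at this ⊢
        rw [h1] at this
        linear_combination this
      · obtain ⟨d, rfl⟩ : ∃ d, a = s + d := ⟨a - s, by ring⟩
        obtain rfl : b = s + 1 - d := by linarith
        have p12 := O1 s
        have p34 := ihO d (d - 2) (by omega) (by omega) (by omega)
        have p13 := ihO (s + 1) d (by omega) (by omega) (by omega)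
        have p24 := ihO s (d - 2) (by omega) (by omega) (by omega)
        have p14 := ihO (s + 1) (d - 2) (by omega) (by omega) (by omega)
        have p23 := ihO s d (by omega) (by omega) (by omega)
        have := (mul_eq_zero.mp (plucker_relation p12 p34 p13 p24 p14 p23)).resolve_left
          (pow_ne_zero _ h2)
        unfold OddNetRel
        ring_nf at this ⊢
        rw [h1] at this
        linear_combination this
    refine ⟨fun a b ha hb h ↦ ?_, fun a b ha hb h ↦ ?_⟩
    · push_cast at h
      rcases le_total b a with hab | hab
      · exact keyE a b hab hb h
      · exact (keyE b a hab ha (by omega)).symm hW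
    · push_cast at h
      rcases le_total b a with hab | hab
      · exact keyO a b hab hb h
      · exact (keyO b a hab ha (by omega)).symm hW

/-- A normalised elliptic divisibility sequence is an elliptic sequence. -/
theorem evenNetRel_normEDS (b c d : R) {m n : ℤ} (hm : 0 ≤ m) (hn : 0 ≤ n) :
    EvenNetRel (normEDS b c d) m n := by
  -- The induction cancels W 2, so it is run over the universal domain ℤ[b, c, d], where W 2 is a
  -- variable, and then specialized.
  let g : MvPolynomial (Fin 3) ℤ →+* R := MvPolynomial.eval₂Hom (Int.castRingHom R) ![b, c, d]
  let X : Fin 3 → MvPolynomial (Fin 3) ℤ := MvPolynomial.X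
  have key := (netRel_aux (W := normEDS (X 0) (X 1) (X 2)) (normEDS_neg _ _ _)
    (normEDS_zero _ _ _) (normEDS_one _ _ _)
    (by rw [normEDS_two]; exact MvPolynomial.X_ne_zero _) (normEDS_odd _ _ _)
    (fun m ↦ by simpa using normEDS_even (X 0) (X 1) (X 2) m) (m + n).toNat).1 m n hm hn
    (by omega)
  have hb : g (X 0) = b := by simp [g, X]
  have hc : g (X 1) = c := by simp [g, X]
  have hd : g (X 2) = d := by simp [g, X]
  have := congrArg g key
  simpa only [EvenNetRel, map_mul, map_sub, map_pow, map_normEDS, hb, hc, hd] using this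

end EllipticNet

/-! ### Division polynomials and multiples of a point on a Weierstrass curve. -/

section GroupLaw

namespace WeierstrassCurve

open Polynomial WeierstrassCurve.Affine

variable {F : Type*} [Field F] (W : WeierstrassCurve F)

/-- The `x`-coordinate of a point, equal to `0` at infinity. -/
def xCoord {W : WeierstrassCurve F} : W.toAffine.Point → F
  | .zero => 0
  | .some x _ _ => x

variable {W}

lemma xCoord_neg (P : W.toAffine.Point) : xCoord (-P) = xCoord P := by
  rcases P with _ | ⟨x, y, h⟩
  · rfl
  · rfl

lemma xCoord_eq_iff {P Q : W.toAffine.Point} (hP : P ≠ 0) (hQ : Q ≠ 0) :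
    xCoord P = xCoord Q ↔ P = Q ∨ P = -Q := by
  rcases P with _ | ⟨x, y, h⟩
  · exact absurd rfl hP
  rcases Q with _ | ⟨x', y', h'⟩
  · exact absurd rfl hQ
  exact Point.X_eq_iff

lemma xCoord_add_some {x₁ y₁ x₂ y₂ : F} (h₁ : W.toAffine.Nonsingular x₁ y₁)
    (h₂ : W.toAffine.Nonsingular x₂ y₂) (hx : x₁ ≠ x₂) :
    xCoord (Point.some x₁ y₁ h₁ + Point.some x₂ y₂ h₂) * (x₁ - x₂) ^ 2 =
      (y₁ - y₂) ^ 2 + W.a₁ * (y₁ - y₂) * (x₁ - x₂) - (W.a₂ + x₁ + x₂) * (x₁ - x₂) ^ 2 := by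
  rw [Point.add_of_X_ne hx]
  have : x₁ - x₂ ≠ 0 := sub_ne_zero.mpr hx
  simp only [xCoord, addX, slope_of_X_ne hx]
  field_simp
  ring

lemma xCoord_add_add_xCoord_sub {P Q : W.toAffine.Point} (hP : P ≠ 0) (hQ : Q ≠ 0)
    (h : xCoord P ≠ xCoord Q) :
    (xCoord (P + Q) + xCoord (P - Q)) * (xCoord P - xCoord Q) ^ 2 =
      2 * xCoord P * xCoord Q * (xCoord P + xCoord Q) + W.b₂ * xCoord P * xCoord Q +
        W.b₄ * (xCoord P + xCoord Q) + W.b₆ := by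
  rcases P with _ | ⟨x, y, h₁⟩
  · exact absurd rfl hP
  rcases Q with _ | ⟨x', y', h₂⟩
  · exact absurd rfl hQ
  have e₁ := (equation_iff ..).mp h₁.1
  have e₂ := (equation_iff ..).mp h₂.1
  have s := xCoord_add_some h₁ h₂ h
  have d := xCoord_add_some h₁ ((nonsingular_neg ..).mpr h₂) h
  rw [← Point.neg_some h₂, ← sub_eq_add_neg] at d
  simp only [negY] at d
  change (_ + _) * (x - x') ^ 2 = _
  rw [add_mul, s, d]
  simp only [xCoord, b₂, b₄, b₆]
  linear_combination 2 * e₁ + 2 * e₂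

lemma xCoord_add_mul_xCoord_sub {P Q : W.toAffine.Point} (hP : P ≠ 0) (hQ : Q ≠ 0)
    (h : xCoord P ≠ xCoord Q) :
    xCoord (P + Q) * xCoord (P - Q) * (xCoord P - xCoord Q) ^ 2 =
      (xCoord P * xCoord Q) ^ 2 - W.b₄ * xCoord P * xCoord Q -
        W.b₆ * (xCoord P + xCoord Q) - W.b₈ := by
  rcases P with _ | ⟨x, y, h₁⟩
  · exact absurd rfl hP
  rcases Q with _ | ⟨x', y', h₂⟩
  · exact absurd rfl hQ
  have e₁ := (equation_iff ..).mp h₁.1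
  have e₂ := (equation_iff ..).mp h₂.1
  have s := xCoord_add_some h₁ h₂ h
  have d := xCoord_add_some h₁ ((nonsingular_neg ..).mpr h₂) h
  rw [← Point.neg_some h₂, ← sub_eq_add_neg] at d
  simp only [negY] at d
  have hx : (x - x') ^ 2 ≠ 0 := pow_ne_zero _ (sub_ne_zero.mpr h)
  apply mul_right_cancel₀ hx
  change _ * (x - x') ^ 2 * _ = _ * (x - x') ^ 2
  rw [show ∀ a b c : F, a * b * c * c = (a * c) * (b * c) by intros; ring, s, d]
  simp only [xCoord, b₄, b₆, b₈]
  linear_combination (y ^ 2 + y * x * W.a₁ + y * W.a₃ - 2 * y' ^ 2 - 2 * y' * x' * W.a₁ -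
    2 * y' * W.a₃ - x ^ 3 + 2 * x ^ 2 * x' - x ^ 2 * W.a₂ + 2 * x * x' ^ 2 + x * x' * W.a₁ ^ 2 +
    4 * x * x' * W.a₂ + x * W.a₁ * W.a₃ + x * W.a₄ - 2 * x' ^ 3 - x' ^ 2 * W.a₁ ^ 2 -
    2 * x' ^ 2 * W.a₂ - x' * W.a₁ * W.a₃ + W.a₆) * e₁ + (y' ^ 2 + y' * x' * W.a₁ + y' * W.a₃ -
    4 * x ^ 3 + 2 * x ^ 2 * x' - x ^ 2 * W.a₁ ^ 2 - 4 * x ^ 2 * W.a₂ + 2 * x * x' ^ 2 +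
    x * x' * W.a₁ ^ 2 + 4 * x * x' * W.a₂ - x * W.a₁ * W.a₃ - 2 * x * W.a₄ - x' ^ 3 -
    x' ^ 2 * W.a₂ + x' * W.a₁ * W.a₃ + x' * W.a₄ - W.a₆) * e₂

lemma two_nsmul_eq_zero_iff {x y : F} (h : W.toAffine.Nonsingular x y) :
    (2 : ℕ) • Point.some x y h = 0 ↔ 2 * y + W.a₁ * x + W.a₃ = 0 := by
  rw [two_nsmul, add_eq_zero_iff_eq_neg, Point.neg_some, Point.some.injEq]
  simp only [true_and, negY]
  constructor <;> intro h' <;> linear_combination h'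

lemma xCoord_two_nsmul {x y : F} (h : W.toAffine.Nonsingular x y)
    (h2 : 2 * y + W.a₁ * x + W.a₃ ≠ 0) :
    xCoord (2 • Point.some x y h) * (2 * y + W.a₁ * x + W.a₃) ^ 2 =
      x ^ 4 - W.b₄ * x ^ 2 - 2 * W.b₆ * x - W.b₈ := by
  have hy : y ≠ W.toAffine.negY x y := fun h' ↦ h2 <| by
    simp only [negY] at h'
    linear_combination h'
  have e := (equation_iff ..).mp h.1
  rw [two_nsmul, Point.add_self_of_Y_ne hy]
  simp only [xCoord, addX, slope_of_Y_ne rfl hy, negY]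
  have key (n D : F) (hD : D ≠ 0) : ((n / D) ^ 2 + W.a₁ * (n / D) - W.a₂ - x - x) * D ^ 2 =
      n ^ 2 + W.a₁ * n * D - (W.a₂ + 2 * x) * D ^ 2 := by
    field_simp
    ring
  rw [show y - (-y - W.a₁ * x - W.a₃) = 2 * y + W.a₁ * x + W.a₃ by ring, key _ _ h2]
  simp only [b₄, b₆, b₈]
  linear_combination (-8 * x - W.a₁ ^ 2 - 4 * W.a₂) * e

/-- The value of the `n`-th division polynomial at a point. -/
noncomputable def divisionValue (W : WeierstrassCurve F) (x y : F) (n : ℤ) : F :=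
  normEDS (2 * y + W.a₁ * x + W.a₃) (W.Ψ₃.eval x) (W.preΨ₄.eval x) n

lemma eval_Ψ₂Sq_of_equation {x y : F} (h : W.toAffine.Equation x y) :
    W.Ψ₂Sq.eval x = (2 * y + W.a₁ * x + W.a₃) ^ 2 := by
  have e := (equation_iff ..).mp h
  simp only [Ψ₂Sq, b₂, b₄, b₆, eval_add, eval_mul, eval_C, eval_pow, eval_X]
  linear_combination -4 * e

lemma eval_preΨ_even {x y : F} (h : W.toAffine.Equation x y) {n : ℤ} (hn : Even n) :
    (W.preΨ n).eval x * (2 * y + W.a₁ * x + W.a₃) = W.divisionValue x y n := by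
  rw [divisionValue, normEDS, if_pos hn, preΨ, ← coe_evalRingHom, map_preNormEDS,
    coe_evalRingHom, eval_pow, eval_Ψ₂Sq_of_equation h, ← pow_mul]

lemma eval_preΨ_odd {x y : F} (h : W.toAffine.Equation x y) {n : ℤ} (hn : ¬ Even n) :
    (W.preΨ n).eval x = W.divisionValue x y n := by
  rw [divisionValue, normEDS, if_neg hn, preΨ, ← coe_evalRingHom, map_preNormEDS,
    coe_evalRingHom, eval_pow, eval_Ψ₂Sq_of_equation h, ← pow_mul, mul_one]

lemma eval_ΨSq_of_equation {x y : F} (h : W.toAffine.Equation x y) (n : ℤ) :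
    (W.ΨSq n).eval x = W.divisionValue x y n ^ 2 := by
  by_cases hn : Even n
  · rw [← eval_preΨ_even h hn, ΨSq, if_pos hn, eval_mul, eval_pow, eval_Ψ₂Sq_of_equation h]
    ring
  · rw [← eval_preΨ_odd h hn, ΨSq, if_neg hn, eval_mul, eval_pow, eval_one, mul_one]

lemma eval_Φ_of_equation {x y : F} (h : W.toAffine.Equation x y) (n : ℤ) :
    (W.Φ n).eval x = x * W.divisionValue x y n ^ 2 -
      W.divisionValue x y (n + 1) * W.divisionValue x y (n - 1) := by
  rw [WeierstrassCurve.Φ, eval_sub, eval_mul, eval_X, eval_ΨSq_of_equation h]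
  by_cases hn : Even n
  · rw [← eval_preΨ_odd h (show ¬ Even (n + 1) by grind),
      ← eval_preΨ_odd h (show ¬ Even (n - 1) by grind), if_pos hn]
    simp
  · rw [← eval_preΨ_even h (show Even (n + 1) by grind),
      ← eval_preΨ_even h (show Even (n - 1) by grind), if_neg hn]
    simp only [eval_mul, eval_Ψ₂Sq_of_equation h]
    ring

lemma divisionValue_rel (W : WeierstrassCurve F) (x y : F) {m n : ℤ} (hm : 0 ≤ m) (hn : 0 ≤ n) :
    W.divisionValue x y (m + n) * W.divisionValue x y (m - n) =
      W.divisionValue x y (m + 1) * W.divisionValue x y (m - 1) * W.divisionValue x y n ^ 2 -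
        W.divisionValue x y (n + 1) * W.divisionValue x y (n - 1) * W.divisionValue x y m ^ 2 :=
  evenNetRel_normEDS _ _ _ hm hn

@[simp] lemma divisionValue_zero (x y : F) : W.divisionValue x y 0 = 0 := normEDS_zero ..

@[simp] lemma divisionValue_one (x y : F) : W.divisionValue x y 1 = 1 := normEDS_one ..

lemma divisionValue_two (x y : F) : W.divisionValue x y 2 = 2 * y + W.a₁ * x + W.a₃ :=
  normEDS_two ..

lemma divisionValue_three (x y : F) : W.divisionValue x y 3 = W.Ψ₃.eval x := normEDS_three ..

lemma divisionValue_four (x y : F) : W.divisionValue x y 4 =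
    W.preΨ₄.eval x * (2 * y + W.a₁ * x + W.a₃) := normEDS_four ..

lemma eval_preΨ₄ (W : WeierstrassCurve F) (x : F) :
    W.preΨ₄.eval x = (6 * x ^ 2 + W.b₂ * x + W.b₄) * W.Ψ₃.eval x - W.Ψ₂Sq.eval x ^ 2 := by
  simp only [preΨ₄, Ψ₃, Ψ₂Sq, eval_add, eval_mul, eval_C, eval_pow, eval_X, eval_ofNat]
  linear_combination (x ^ 2) * W.b_relation

lemma eval_Ψ₃_of_two_torsion {x y : F} (h : W.toAffine.Equation x y)
    (h2 : 2 * y + W.a₁ * x + W.a₃ = 0) :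
    W.Ψ₃.eval x = -(W.a₁ * y - (3 * x ^ 2 + 2 * W.a₂ * x + W.a₄)) ^ 2 := by
  have e := (equation_iff ..).mp h
  simp only [Ψ₃, b₂, b₄, b₆, b₈, eval_add, eval_mul, eval_C, eval_pow, eval_X, eval_ofNat]
  linear_combination (3 * x * (2 * y + W.a₁ * x + W.a₃) + W.a₂ * (2 * y + W.a₁ * x + W.a₃) -
    W.a₁ * (3 * x ^ 2 + 2 * W.a₂ * x + W.a₄ - W.a₁ * y)) * h2 +
    (-12 * x - W.a₁ ^ 2 - 4 * W.a₂) * e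

/-- At a 2-torsion point the y-derivative of the equation vanishes and ψ₃ is minus the square of the
x-derivative, so nonsingularity applies. -/
lemma Ψ₃_ne_zero_of_two_torsion {x y : F} (h : W.toAffine.Nonsingular x y)
    (h2 : 2 * y + W.a₁ * x + W.a₃ = 0) : W.Ψ₃.eval x ≠ 0 := by
  rw [eval_Ψ₃_of_two_torsion h.1 h2]
  refine neg_ne_zero.mpr (pow_ne_zero _ fun h0 ↦ ?_)
  rcases ((nonsingular_iff' ..).mp h).2 with h' | h'
  · exact h' h0
  · exact h' h2

section multiples

variable {x y : F} (h : W.toAffine.Nonsingular x y)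

local notation "𝐏" => Point.some x y h
local notation "ψ" => divisionValue W x y

include h in
/-- The multiplication formula, as long as no smaller multiple vanishes. -/
lemma divisionValue_ne_zero_and_xCoord_nsmul (n : ℕ) (hn : 1 ≤ n)
    (hP : ∀ k : ℕ, 1 ≤ k → k ≤ n → k • 𝐏 ≠ 0) :
    ψ n ≠ 0 ∧ xCoord (n • 𝐏) * ψ n ^ 2 = x * ψ n ^ 2 - ψ (n + 1) * ψ (n - 1) := by
  have hP0 : 𝐏 ≠ 0 := Point.some_ne_zero h
  have hB := eval_Ψ₂Sq_of_equation h.1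
  have ne_x : ∀ k : ℕ, 2 ≤ k → k + 1 ≤ n → xCoord (k • 𝐏) ≠ x := by
    intro k hk hkn hx
    rcases (xCoord_eq_iff (hP k (by omega) (by omega)) hP0).mp hx with h' | h'
    · have : (k - 1) • 𝐏 = 0 := by
        have : k • 𝐏 = (k - 1) • 𝐏 + 𝐏 := by rw [← succ_nsmul]; congr 1; omega
        rw [h'] at this
        exact right_eq_add.mp this
      exact hP (k - 1) (by omega) (by omega) this
    · exact hP (k + 1) (by omega) hkn (by rw [succ_nsmul, h', neg_add_cancel])
  induction n using Nat.strong_induction_on with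
  | _ n ih =>
  have ih' : ∀ k : ℕ, k < n → 1 ≤ k → ψ k ≠ 0 ∧
      xCoord (k • 𝐏) * ψ k ^ 2 = x * ψ k ^ 2 - ψ (k + 1) * ψ (k - 1) := fun k hk h1 ↦
    ih k hk h1 (fun j hj hjk ↦ hP j hj (by omega)) (fun j hj hjk ↦ ne_x j hj (by omega))
  obtain rfl | rfl | rfl | hn4 : n = 1 ∨ n = 2 ∨ n = 3 ∨ 4 ≤ n := by omega
  · simp [xCoord]
  · have h2 : 2 * y + W.a₁ * x + W.a₃ ≠ 0 := fun h0 ↦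
      hP 2 one_le_two le_rfl ((two_nsmul_eq_zero_iff h).mpr h0)
    have := xCoord_two_nsmul h h2
    norm_num
    rw [divisionValue_two, divisionValue_three]
    refine ⟨h2, ?_⟩
    rw [this, ← hB]
    simp only [Ψ₃, Ψ₂Sq, eval_add, eval_mul, eval_C, eval_pow, eval_X, eval_ofNat]
    ring
  · have h2 : 2 * y + W.a₁ * x + W.a₃ ≠ 0 := fun h0 ↦
      hP 2 one_le_two (by norm_num) ((two_nsmul_eq_zero_iff h).mpr h0)
    obtain ⟨-, e2⟩ := ih' 2 (by norm_num) (by norm_num)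
    have hx2 := ne_x 2 le_rfl le_rfl
    have e3 := xCoord_add_add_xCoord_sub (hP 2 one_le_two (by norm_num)) hP0 hx2
    rw [← succ_nsmul, show 2 • 𝐏 - 𝐏 = 𝐏 by rw [two_nsmul, add_sub_cancel_right]] at e3
    norm_num at e2 e3 ⊢
    rw [divisionValue_two, divisionValue_three] at e2
    rw [divisionValue_two, divisionValue_three, divisionValue_four, eval_preΨ₄, hB]
    simp only [show xCoord 𝐏 = x from rfl] at e3
    set X₂ := xCoord (2 • 𝐏)
    set X₃ := xCoord (3 • 𝐏)
    set D := 2 * y + W.a₁ * x + W.a₃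
    set c := W.Ψ₃.eval x
    have hD : D ^ 2 = 4 * x ^ 3 + W.b₂ * x ^ 2 + 2 * W.b₄ * x + W.b₆ := by
      rw [← hB]
      simp only [Ψ₂Sq, eval_add, eval_mul, eval_C, eval_pow, eval_X]
    have hc : c = (x - X₂) * D ^ 2 := by linear_combination e2
    refine ⟨fun h0 ↦ ?_, ?_⟩
    · rw [h0, zero_eq_mul] at hc
      rcases hc with hc | hc
      · exact hx2 (sub_eq_zero.mp hc).symm
      · exact h2 (pow_eq_zero_iff two_ne_zero |>.mp hc)
    · rw [hc]
      linear_combination D ^ 4 * e3 - D ^ 4 * hD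
  · obtain ⟨m, rfl⟩ : ∃ m, n = m + 1 := ⟨n - 1, by omega⟩
    obtain ⟨hm0, em⟩ := ih' m (by omega) (by omega)
    obtain ⟨hl0, el⟩ := ih' (m - 1) (by omega) (by omega)
    have hxm := ne_x m (by omega) le_rfl
    have hxl := ne_x (m - 1) (by omega) (by omega)
    have e3 := xCoord_add_add_xCoord_sub (hP m (by omega) (by omega)) hP0 hxm
    have e4 := xCoord_add_mul_xCoord_sub (hP m (by omega) (by omega)) hP0 hxm
    have hl : m • 𝐏 - 𝐏 = (m - 1) • 𝐏 := by
      rw [sub_eq_iff_eq_add, ← succ_nsmul]; congr 1; omega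
    rw [← succ_nsmul, hl] at e3 e4
    have somos := divisionValue_rel W x y (m := m) (n := 2) (by omega) (by norm_num)
    norm_num [divisionValue_two, divisionValue_three] at somos
    push_cast [show 1 ≤ m by omega] at *
    rw [show (m : ℤ) - 1 + 1 = m by ring, show (m : ℤ) - 1 - 1 = m - 2 by ring] at el
    rw [show (m : ℤ) + 1 + 1 = m + 2 by ring, show (m : ℤ) + 1 - 1 = m by ring]
    simp only [show xCoord 𝐏 = x from rfl] at e3 e4
    set Xm := xCoord (m • 𝐏)
    set Xl := xCoord ((m - 1) • 𝐏)
    set Xn := xCoord ((m + 1) • 𝐏)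
    set D := 2 * y + W.a₁ * x + W.a₃
    set c := W.Ψ₃.eval x with hc
    have hD : D ^ 2 = 4 * x ^ 3 + W.b₂ * x ^ 2 + 2 * W.b₄ * x + W.b₆ := by
      rw [← hB]
      simp only [Ψ₂Sq, eval_add, eval_mul, eval_C, eval_pow, eval_X]
    simp only [Ψ₃, eval_add, eval_mul, eval_C, eval_pow, eval_X, eval_ofNat] at hc
    -- The sum and product of x((m+1)P) and x((m-1)P) are known, so (x - Xn)(x - Xl) is known too.
    -- This matches the relation for ψ(m+2)ψ(m-2), and dividing by the inductive formulas for Xm and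
    -- Xl isolates Xn.
    have prod : (x - Xn) * (x - Xl) * (x - Xm) ^ 2 = D ^ 2 * (x - Xm) - c := by
      rw [hD, hc]
      linear_combination e4 - x * e3
    have fm : (x - Xm) * ψ m ^ 2 = ψ (m + 1) * ψ (m - 1) := by linear_combination -em
    have fl : (x - Xl) * ψ (m - 1) ^ 2 = ψ m * ψ (m - 2) := by linear_combination -el
    have hxm' : x - Xm ≠ 0 := sub_ne_zero.mpr (Ne.symm hxm)
    have hxl' : x - Xl ≠ 0 := sub_ne_zero.mpr (Ne.symm hxl)
    have hn0 : ψ (m + 1) ≠ 0 := fun h0 ↦ by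
      rw [h0, zero_mul] at fm
      exact mul_ne_zero hxm' (pow_ne_zero _ hm0) fm
    refine ⟨hn0, ?_⟩
    have hne : (x - Xl) * ψ (m - 1) ^ 2 * ((x - Xm) * ψ m ^ 2) ^ 2 ≠ 0 := by positivity
    suffices h : (x - Xn) * ψ (m + 1) ^ 2 = ψ (m + 2) * ψ m by linear_combination -h
    apply mul_right_cancel₀ hne
    linear_combination ψ (m + 1) ^ 2 * ψ (m - 1) ^ 2 * ψ m ^ 4 * prod +
      (D ^ 2 * ψ m ^ 2 * ψ (m + 1) ^ 2 * ψ (m - 1) ^ 2 - ψ (m + 2) * ψ (m - 2) * ψ m ^ 2 *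
        ((x - Xm) * ψ m ^ 2 + ψ (m + 1) * ψ (m - 1))) * fm -
      ψ m ^ 2 * ψ (m + 1) ^ 2 * ψ (m - 1) ^ 2 * somos -
      ψ (m + 2) * ψ m * ((x - Xm) * ψ m ^ 2) ^ 2 * fl

include h in
lemma nsmul_addOrderOf_sub_one (hd : 2 ≤ addOrderOf 𝐏) : (addOrderOf 𝐏 - 1) • 𝐏 = -𝐏 := by
  rw [eq_neg_iff_add_eq_zero, ← succ_nsmul, Nat.sub_add_cancel (by omega), addOrderOf_nsmul_eq_zero]

include h in
lemma divisionValue_ne_zero_of_lt_addOrderOf {n : ℕ} (hn : 1 ≤ n) (hd : n < addOrderOf 𝐏) :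
    ψ n ≠ 0 :=
  (divisionValue_ne_zero_and_xCoord_nsmul h n hn fun _ hk hkn h0 ↦
    absurd (addOrderOf_le_of_nsmul_eq_zero (by omega) h0) (by omega)).1

-- If P has order d, then (d-1)P = -P has the same x-coordinate as P, so the multiplication formula
-- at d-1 gives ψ(d)ψ(d-2) = 0, and ψ(d-2) ≠ 0. Order 2 is handled directly.
include h in
lemma divisionValue_addOrderOf (hd : 2 ≤ addOrderOf 𝐏) : ψ (addOrderOf 𝐏) = 0 := by
  obtain h2 | h3 : addOrderOf 𝐏 = 2 ∨ 3 ≤ addOrderOf 𝐏 := by omega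
  · rw [h2]
    exact (divisionValue_two ..).trans <|
      (two_nsmul_eq_zero_iff h).mp (h2 ▸ addOrderOf_nsmul_eq_zero 𝐏)
  obtain ⟨d, hd⟩ : ∃ d, addOrderOf 𝐏 = d + 1 := ⟨addOrderOf 𝐏 - 1, by omega⟩
  have e := (divisionValue_ne_zero_and_xCoord_nsmul h d (by omega) fun _ hk hkn h0 ↦
    absurd (addOrderOf_le_of_nsmul_eq_zero (by omega) h0) (by omega)).2
  have hneg := nsmul_addOrderOf_sub_one h (by omega)
  rw [hd, Nat.add_sub_cancel] at hneg
  rw [hneg, xCoord_neg, show xCoord 𝐏 = x from rfl, eq_comm, sub_eq_self] at e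
  have h0 := divisionValue_ne_zero_of_lt_addOrderOf h (n := d - 1) (by omega) (by omega)
  rw [hd]
  push_cast [show 1 ≤ d by omega] at h0 ⊢
  exact (mul_eq_zero.mp e).resolve_right h0

-- Two consecutive zeros at d and d+1 would force ψ(3)ψ(d-1)^2 = 0 in the relation for the pair
-- (d-1, 2), impossible when d ≥ 4. For d = 2 the value is ψ₃; for d = 3 it is -ψ₂^5.
include h in
lemma divisionValue_addOrderOf_add_one (hd : 2 ≤ addOrderOf 𝐏) :
    ψ (addOrderOf 𝐏 + 1) ≠ 0 := by
  have hz := divisionValue_addOrderOf h hd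
  obtain h2 | h3 | h4 : addOrderOf 𝐏 = 2 ∨ addOrderOf 𝐏 = 3 ∨ 4 ≤ addOrderOf 𝐏 := by omega
  · rw [h2] at hz ⊢
    norm_num [divisionValue_three]
    exact Ψ₃_ne_zero_of_two_torsion h ((divisionValue_two ..).symm.trans hz)
  · rw [h3] at hz ⊢
    have hD := divisionValue_ne_zero_of_lt_addOrderOf h one_le_two (by omega)
    norm_num [divisionValue_three, divisionValue_two] at hz hD ⊢
    rw [divisionValue_four, eval_preΨ₄, hz, eval_Ψ₂Sq_of_equation h.1, mul_zero, zero_sub, neg_mul]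
    exact neg_ne_zero.mpr (mul_ne_zero (pow_ne_zero _ (pow_ne_zero _ hD)) hD)
  · intro h0
    have h3 := divisionValue_ne_zero_of_lt_addOrderOf h (n := 3) (by norm_num) (by omega)
    have hd1 := divisionValue_ne_zero_of_lt_addOrderOf h (n := addOrderOf 𝐏 - 1) (by omega)
      (by omega)
    have := divisionValue_rel W x y (m := addOrderOf 𝐏 - 1) (n := 2) (by omega) (by norm_num)
    rw [sub_add_cancel, hz, show (addOrderOf 𝐏 : ℤ) - 1 + 2 = addOrderOf 𝐏 + 1 by ring, h0] at this
    norm_num at this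
    push_cast [show 1 ≤ addOrderOf 𝐏 by omega] at hd1
    exact this.elim h3 hd1

include h in
/-- A division polynomial vanishes only at torsion points. -/
theorem divisionValue_ne_zero {n : ℕ} (hn : n • 𝐏 ≠ 0) : ψ n ≠ 0 := by
  have hn1 : 1 ≤ n := Nat.one_le_iff_ne_zero.mpr fun h0 ↦ hn (by rw [h0, zero_nsmul])
  by_cases h0 : addOrderOf 𝐏 = 0
  · refine (divisionValue_ne_zero_and_xCoord_nsmul h n hn1 fun k hk _ h0' ↦ ?_).1
    exact absurd h0 (addOrderOf_pos_iff.mpr (isOfFinAddOrder_iff_nsmul_eq_zero.mpr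
      ⟨k, by omega, h0'⟩)).ne'
  have h1 : addOrderOf 𝐏 ≠ 1 := fun h1 ↦
    Point.some_ne_zero h (AddMonoid.addOrderOf_eq_one_iff.mp h1)
  have hz := divisionValue_addOrderOf h (by omega)
  have hd1 := divisionValue_addOrderOf_add_one h (by omega)
  have hd2 := divisionValue_ne_zero_of_lt_addOrderOf h (n := addOrderOf 𝐏 - 1) (by omega) (by omega)
  push_cast [show 1 ≤ addOrderOf 𝐏 by omega] at hd2
  -- With ψ(d) = 0 the relation reads ψ(m+d)ψ(m-d) = -ψ(d+1)ψ(d-1)ψ(m)^2, so nonvanishing propagates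
  -- by steps of d from the remainders 0 < r < d.
  have step (m : ℕ) (hm : ψ m ≠ 0) : ψ (m + addOrderOf 𝐏 : ℕ) ≠ 0 := fun h0 ↦ by
    have := divisionValue_rel W x y (m := m) (n := addOrderOf 𝐏) (by omega) (by omega)
    push_cast at h0
    rw [h0, hz] at this
    norm_num [hm, hd1, hd2] at this
  have all (q r : ℕ) (hr : ψ r ≠ 0) : ψ (r + addOrderOf 𝐏 * q : ℕ) ≠ 0 := by
    induction q with
    | zero => simpa using hr
    | succ q ih => simpa only [Nat.mul_succ, ← add_assoc] using step _ ih
  rw [← Nat.mod_add_div n (addOrderOf 𝐏)]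
  refine all _ _ (divisionValue_ne_zero_of_lt_addOrderOf h ?_ (Nat.mod_lt _ (by omega)))
  exact Nat.one_le_iff_ne_zero.mpr fun h0 ↦
    hn (addOrderOf_dvd_iff_nsmul_eq_zero.mp (Nat.dvd_of_mod_eq_zero h0))

end multiples

end WeierstrassCurve
end GroupLaw

/-! ### The p-torsion over an algebraically closed field of characteristic zero. -/

section Torsion

namespace WeierstrassCurve

open Polynomial WeierstrassCurve.Affine

variable {F : Type*} [Field F] {W : WeierstrassCurve F}

lemma eval_ΨSq_xCoord_eq_zero {n : ℕ} {P : W.toAffine.Point} (hP : P ≠ 0)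
    (h : (W.ΨSq n).eval (xCoord P) = 0) : n • P = 0 := by
  rcases P with _ | ⟨x, y, hxy⟩
  · exact absurd rfl hP
  by_contra h0
  rw [xCoord, eval_ΨSq_of_equation hxy.1] at h
  exact divisionValue_ne_zero hxy h0 (pow_eq_zero_iff two_ne_zero |>.mp h)

lemma eval_ΨSq_xCoord_addOrderOf {P : W.toAffine.Point} (hP : P ≠ 0)
    (hd : 2 ≤ addOrderOf P) : (W.ΨSq (addOrderOf P)).eval (xCoord P) = 0 := by
  rcases P with _ | ⟨x, y, hxy⟩
  · exact absurd rfl hP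
  rw [xCoord, eval_ΨSq_of_equation hxy.1, divisionValue_addOrderOf hxy hd,
    zero_pow two_ne_zero]

lemma eval_ΨSq_odd {n : ℤ} (hn : ¬ Even n) (x : F) :
    (W.ΨSq n).eval x = (W.preΨ n).eval x ^ 2 := by
  simp [ΨSq, hn]

/-- For `p` an odd prime, the roots of the `p`-th division polynomial are the `x`-coordinates
of the nonzero `p`-torsion points. -/
theorem eval_preΨ_xCoord_eq_zero_iff {p : ℕ} (hp : p.Prime) (hp2 : p ≠ 2)
    {P : W.toAffine.Point} (hP : P ≠ 0) :
    (W.preΨ p).eval (xCoord P) = 0 ↔ p • P = 0 := by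
  have hodd : ¬ Even (p : ℤ) := by
    rw [Int.not_even_iff_odd]; exact_mod_cast hp.odd_of_ne_two hp2
  rw [← pow_eq_zero_iff two_ne_zero, ← eval_ΨSq_odd hodd]
  refine ⟨eval_ΨSq_xCoord_eq_zero hP, fun h ↦ ?_⟩
  have hord : addOrderOf P = p := by
    have := Fact.mk hp
    exact addOrderOf_eq_prime h hP
  rw [← hord]
  exact eval_ΨSq_xCoord_addOrderOf hP (hord ▸ hp.two_le)

lemma xCoord_nsmul {n : ℕ} (hn : 1 ≤ n) {P : W.toAffine.Point}
    (hP : ∀ k : ℕ, 1 ≤ k → k ≤ n → k • P ≠ 0) :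
    xCoord (n • P) * (W.ΨSq n).eval (xCoord P) = (W.Φ n).eval (xCoord P) := by
  rcases P with _ | ⟨x, y, hxy⟩
  · exact absurd (nsmul_zero 1) (hP 1 le_rfl hn)
  change _ * eval x _ = eval x _
  rw [eval_ΨSq_of_equation hxy.1, eval_Φ_of_equation hxy.1]
  exact (divisionValue_ne_zero_and_xCoord_nsmul hxy n hn hP).2

/-- At a point of order p, Φ_p = xψ_p^2 - ψ_{p+1}ψ_{p-1} reduces to -ψ_{p+1}ψ_{p-1}, and neither
factor vanishes. -/
lemma eval_Φ_xCoord_ne_zero {p : ℕ} (hp : p.Prime) {P : W.toAffine.Point}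
    (hP : P ≠ 0) (h : p • P = 0) : (W.Φ p).eval (xCoord P) ≠ 0 := by
  have hord : addOrderOf P = p := by
    have := Fact.mk hp
    exact addOrderOf_eq_prime h hP
  rcases P with _ | ⟨x, y, hxy⟩
  · exact absurd rfl hP
  have h2 := hord ▸ hp.two_le
  have h0 := divisionValue_addOrderOf hxy h2
  have h1 := divisionValue_addOrderOf_add_one hxy h2
  have h3 := divisionValue_ne_zero_of_lt_addOrderOf hxy
    (n := addOrderOf (Point.some x y hxy) - 1) (by omega) (by omega)
  change eval x _ ≠ 0
  rw [eval_Φ_of_equation hxy.1]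
  rw [hord] at h0 h1 h3
  push_cast [hp.one_le] at h3
  rw [h0, zero_pow two_ne_zero, mul_zero, zero_sub]
  exact neg_ne_zero.mpr (mul_ne_zero h1 h3)

section IsAlgClosed

variable [IsAlgClosed F] [W.IsElliptic]

variable (W) in
lemma exists_xCoord_eq (x : F) : ∃ P : W.toAffine.Point, P ≠ 0 ∧ xCoord P = x := by
  obtain ⟨y, hy⟩ := IsAlgClosed.exists_root
    (C 1 * X ^ 2 + C (W.a₁ * x + W.a₃) * X + C (-(x ^ 3 + W.a₂ * x ^ 2 + W.a₄ * x + W.a₆)))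
    (by rw [degree_quadratic one_ne_zero]; norm_num)
  have h : W.toAffine.Equation x y := by
    rw [equation_iff]
    simp only [IsRoot, eval_add, eval_mul, eval_C, eval_pow, eval_X] at hy
    linear_combination hy
  exact ⟨Point.some x y (equation_iff_nonsingular.mp h), Point.some_ne_zero _, rfl⟩

lemma preΨ_root {p : ℕ} (hp : p.Prime) (hp2 : p ≠ 2) {x : F} (hx : (W.preΨ p).eval x = 0) :
    ∃ P : W.toAffine.Point, P ≠ 0 ∧ xCoord P = x ∧ p • P = 0 := by
  obtain ⟨P, hP, rfl⟩ := exists_xCoord_eq W x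
  exact ⟨P, hP, rfl, (eval_preΨ_xCoord_eq_zero_iff hp hp2 hP).mp hx⟩

lemma isCoprime_Φ_preΨ {p : ℕ} (hp : p.Prime) (hp2 : p ≠ 2) :
    IsCoprime (W.Φ p) (W.preΨ p) := by
  rw [isCoprime_iff_aeval_ne_zero_of_isAlgClosed F F]
  intro x
  by_contra! h
  simp only [coe_aeval_eq_eval] at h
  obtain ⟨P, hP, rfl, hpP⟩ := preΨ_root hp hp2 h.2
  exact eval_Φ_xCoord_ne_zero hp hP hpP h.1

variable [CharZero F]

variable (W) in
/-- There is a point with at least `p ^ 2` preimages under multiplication by `p`. -/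
lemma exists_fibre {p : ℕ} (hp : p.Prime) (hp2 : p ≠ 2) :
    ∃ (Q : W.toAffine.Point) (s : Finset W.toAffine.Point),
      p ^ 2 ≤ s.card ∧ ∀ P ∈ s, p • P = Q := by
  have hodd : ¬ Even (p : ℤ) := by
    rw [Int.not_even_iff_odd]; exact_mod_cast hp.odd_of_ne_two hp2
  have hpF : (((p : ℕ) : ℤ) : F) ≠ 0 := by exact_mod_cast hp.ne_zero
  set f := W.Φ p
  set g := W.preΨ p
  have hg0 : g ≠ 0 := W.preΨ_ne_zero hpF
  have hcop : IsCoprime f g := isCoprime_Φ_preΨ hp hp2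
  -- This is the numerator of the derivative of f/g^2. If it vanished, coprimality would give g ∣
  -- g', impossible for a nonconstant g in characteristic zero.
  have hw : derivative f * g - 2 * f * derivative g ≠ 0 := by
    intro h0
    have hdvd : g ∣ derivative g := by
      refine hcop.symm.dvd_of_dvd_mul_left (y := f) ?_
      have h2 : g ∣ C 2 * (f * derivative g) := ⟨derivative f, by
        rw [map_ofNat]; linear_combination -h0⟩
      exact ((isUnit_C.mpr (IsUnit.mk0 (2 : F) two_ne_zero)).dvd_mul_left).mp h2
    have := derivative_eq_zero.mp (dvd_derivative_iff.mp hdvd)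
    have hpos : 0 < g.natDegree := W.natDegree_preΨ_pos
      (by have := hp.two_le; simp only [Int.natAbs_natCast]; omega) hpF
    omega
  -- The value c of f/g^2 is chosen away from the critical values, so that f - c g^2 is separable,
  -- and away from the images of points killed by some k ≤ p, so that the multiplication formula
  -- applies.
  set B := (derivative f * g - 2 * f * derivative g) * ∏ k ∈ Finset.Icc 1 p, W.ΨSq (k : ℕ)
  have hB : B ≠ 0 := by
    refine mul_ne_zero hw (Finset.prod_ne_zero_iff.mpr fun k hk ↦ W.ΨSq_ne_zero ?_)
    have := (Finset.mem_Icc.mp hk).1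
    exact_mod_cast (by omega : k ≠ 0)
  obtain ⟨c, hc⟩ := Infinite.exists_notMem_finset
    (B.roots.toFinset.image fun z ↦ f.eval z / g.eval z ^ 2)
  obtain ⟨Q, hQ0, hQ⟩ := exists_xCoord_eq W c
  set H := f - C c * g ^ 2
  have key : ∀ z, H.eval z = 0 → g.eval z ≠ 0 ∧ B.eval z ≠ 0 ∧ f.eval z = c * g.eval z ^ 2 := by
    intro z hz
    have hz' : f.eval z = c * g.eval z ^ 2 := by
      simp only [H, eval_sub, eval_mul, eval_C, eval_pow] at hz
      linear_combination hz
    have hgz : g.eval z ≠ 0 := fun h0 ↦ by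
      rw [h0] at hz'
      have := (isCoprime_iff_aeval_ne_zero_of_isAlgClosed F F _ _).mp hcop z
      simp only [coe_aeval_eq_eval] at this
      exact this.elim (fun h ↦ h (by simpa using hz')) (fun h ↦ h h0)
    refine ⟨hgz, fun hBz ↦ hc ?_, hz'⟩
    rw [Finset.mem_image]
    refine ⟨z, by simpa [hB] using hBz, ?_⟩
    rw [hz', mul_div_cancel_right₀ _ (pow_ne_zero _ hgz)]
  have hsep : H.Separable := by
    rw [separable_def, isCoprime_iff_aeval_ne_zero_of_isAlgClosed F F]
    intro z
    by_contra! h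
    simp only [coe_aeval_eq_eval] at h
    obtain ⟨hgz, hBz, hz⟩ := key z h.1
    refine hBz ?_
    have h2 := h.2
    simp only [H, derivative_sub, derivative_mul, derivative_C, derivative_pow, eval_sub,
      eval_add, eval_mul, eval_C, eval_pow, zero_mul, eval_zero] at h2
    simp only [B, eval_mul, eval_sub, eval_ofNat]
    norm_num at h2
    rw [hz, mul_eq_zero]
    left
    linear_combination g.eval z * h2
  have hdeg : H.natDegree = p ^ 2 := by
    have hf : f.natDegree = p ^ 2 := (W.natDegree_Φ (p : ℤ)).trans (by simp)
    have hg : (C c * g ^ 2).natDegree < f.natDegree := by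
      refine (natDegree_C_mul_le _ _).trans_lt ?_
      rw [hf, natDegree_pow, W.natDegree_preΨ hpF, if_neg hodd, Int.natAbs_natCast]
      have := Nat.mul_div_le (p ^ 2 - 1) 2
      have := Nat.pow_pos (n := 2) hp.pos
      omega
    rw [natDegree_sub_eq_left_of_natDegree_lt hg, hf]
  have hpt : ∀ z, H.eval z = 0 → ∃ P : W.toAffine.Point, xCoord P = z ∧ p • P = Q := by
    intro z hz
    obtain ⟨hgz, hBz, hfz⟩ := key z hz
    obtain ⟨P, hP, rfl⟩ := exists_xCoord_eq W z
    have hk : ∀ k : ℕ, 1 ≤ k → k ≤ p → k • P ≠ 0 := by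
      intro k hk1 hkp h0
      have hle := addOrderOf_le_of_nsmul_eq_zero hk1 h0
      have hpos : 0 < addOrderOf P := addOrderOf_pos_iff.mpr
        (isOfFinAddOrder_iff_nsmul_eq_zero.mpr ⟨k, hk1, h0⟩)
      have hne : addOrderOf P ≠ 1 := fun h ↦ hP (AddMonoid.addOrderOf_eq_one_iff.mp h)
      refine hBz ?_
      rw [eval_mul, eval_prod, Finset.prod_eq_zero (i := addOrderOf P), mul_zero]
      · exact Finset.mem_Icc.mpr ⟨hpos, hle.trans hkp⟩
      · exact eval_ΨSq_xCoord_addOrderOf hP (by omega)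
    have hx := xCoord_nsmul hp.one_le hk
    rw [eval_ΨSq_odd hodd, hfz] at hx
    have hx' := mul_right_cancel₀ (pow_ne_zero _ hgz) hx
    rw [← hQ] at hx'
    rcases (xCoord_eq_iff (hk p hp.one_le le_rfl) hQ0).mp hx' with h | h
    · exact ⟨P, rfl, h⟩
    -- A root only determines pP up to sign; replacing P by -P puts the preimage over Q without
    -- changing its x-coordinate.
    · exact ⟨-P, xCoord_neg P, by rw [smul_neg, h, neg_neg]⟩
  choose! q hq1 hq2 using hpt
  refine ⟨Q, H.roots.toFinset.image q, ?_, ?_⟩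
  · rw [Finset.card_image_of_injOn, Multiset.toFinset_card_of_nodup (nodup_roots hsep),
      IsAlgClosed.card_roots_eq_natDegree, hdeg]
    intro z hz z' hz' hzz
    have hr : ∀ {z}, z ∈ (H.roots.toFinset : Set F) → H.eval z = 0 := fun h ↦ by
      simpa [hsep.ne_zero] using h
    rw [← hq1 z (hr hz), ← hq1 z' (hr hz'), hzz]
  · intro P hP
    obtain ⟨z, hz, rfl⟩ := Finset.mem_image.mp hP
    exact hq2 z (by simpa [hsep.ne_zero] using hz)

omit [IsAlgClosed F] [W.IsElliptic] [CharZero F] in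
lemma card_xCoord_fibre_le (s : Finset W.toAffine.Point) (hs : ∀ P ∈ s, P ≠ 0) (x : F) :
    (s.filter fun P ↦ xCoord P = x).card ≤ 2 := by
  rcases (s.filter fun P ↦ xCoord P = x).eq_empty_or_nonempty with h | ⟨P, hP⟩
  · simp [h]
  refine (Finset.card_le_card fun Q hQ ↦ ?_).trans (Finset.card_le_two (a := P) (b := -P))
  rw [Finset.mem_filter] at hP hQ
  have := (xCoord_eq_iff (hs Q hQ.1) (hs P hP.1)).mp (hQ.2.trans hP.2.symm)
  simpa using this

variable (W) in
/-- The structure of the nonzero `p`-torsion points: there are `p ^ 2 - 1` of them, their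
`x`-coordinates are the roots of the `p`-th division polynomial, which are simple, and each root is
the `x`-coordinate of two points. -/
theorem exists_torsion_finset {p : ℕ} (hp : p.Prime) (hp2 : p ≠ 2) :
    ∃ s : Finset W.toAffine.Point, (∀ T, T ∈ s ↔ T ≠ 0 ∧ p • T = 0) ∧ s.card = p ^ 2 - 1 ∧
      (W.preΨ p) = C (p : F) * ∏ r ∈ s.image xCoord, (X - C r) ∧
      ∀ r ∈ s.image xCoord, (s.filter fun P ↦ xCoord P = r).card = 2 := by
  have hodd : ¬ Even (p : ℤ) := by
    rw [Int.not_even_iff_odd]; exact_mod_cast hp.odd_of_ne_two hp2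
  have hpF : (((p : ℕ) : ℤ) : F) ≠ 0 := by exact_mod_cast hp.ne_zero
  set g := W.preΨ p with hg
  have hg0 : g ≠ 0 := W.preΨ_ne_zero hpF
  have hdeg : g.natDegree = (p ^ 2 - 1) / 2 := by
    rw [hg, W.natDegree_preΨ hpF, if_neg hodd, Int.natAbs_natCast]
  have hmaps (s : Finset W.toAffine.Point) (hs : ∀ T ∈ s, T ≠ 0 ∧ p • T = 0) :
      s.image xCoord ⊆ g.roots.toFinset := fun x hx ↦ by
    obtain ⟨T, hT, rfl⟩ := Finset.mem_image.mp hx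
    rw [Multiset.mem_toFinset, mem_roots hg0]
    exact (eval_preΨ_xCoord_eq_zero_iff hp hp2 (hs T hT).1).mpr (hs T hT).2
  have hroots : g.roots.toFinset.card ≤ (p ^ 2 - 1) / 2 :=
    (Multiset.toFinset_card_le _).trans ((card_roots' _).trans_eq hdeg)
  have hsq : 1 ≤ p ^ 2 := Nat.pow_pos hp.pos
  have hle (s : Finset W.toAffine.Point) (hs : ∀ T ∈ s, T ≠ 0 ∧ p • T = 0) :
      s.card ≤ 2 * (s.image xCoord).card :=
    Finset.card_le_mul_card_image _ _ fun x _ ↦ card_xCoord_fibre_le s (fun T hT ↦ (hs T hT).1) x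
  obtain ⟨Q, t, ht, htQ⟩ := exists_fibre W hp hp2
  obtain ⟨P₀, hP₀⟩ : t.Nonempty := Finset.card_pos.mp (by omega)
  -- Differences inside a fibre of size at least p^2 give at least p^2 - 1 nonzero torsion points.
  -- Their x-coordinates are among at most (p^2-1)/2 roots, each taken by at most two points, so all
  -- these bounds are equalities: the roots are simple and each is hit exactly twice.
  set s := (t.image fun P ↦ P - P₀).erase 0
  have hs : ∀ T ∈ s, T ≠ 0 ∧ p • T = 0 := fun T hT ↦ by
    obtain ⟨hT0, hT⟩ := Finset.mem_erase.mp hT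
    obtain ⟨P, hP, rfl⟩ := Finset.mem_image.mp hT
    exact ⟨hT0, by rw [smul_sub, htQ P hP, htQ P₀ hP₀, sub_self]⟩
  have hscard : p ^ 2 - 1 ≤ s.card := by
    refine le_trans ?_ Finset.pred_card_le_card_erase
    rw [Finset.card_image_of_injective _ sub_left_injective]
    omega
  have himg := Finset.card_le_card (hmaps s hs)
  have h1 := hle s hs
  have heven : 2 ∣ p ^ 2 - 1 := by
    have : Odd (p ^ 2) := (hp.odd_of_ne_two hp2).pow
    obtain ⟨k, hk⟩ := this
    exact ⟨k, by omega⟩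
  have hNcard : (s.image xCoord).card = (p ^ 2 - 1) / 2 := by omega
  have himage : s.image xCoord = g.roots.toFinset :=
    Finset.eq_of_subset_of_card_le (hmaps s hs) (by omega)
  refine ⟨s, fun T ↦ ⟨hs T, fun hT ↦ ?_⟩, by omega, ?_, ?_⟩
  · by_contra hTs
    have hs' : ∀ T' ∈ insert T s, T' ≠ 0 ∧ p • T' = 0 := fun T' hT' ↦ by
      rcases Finset.mem_insert.mp hT' with rfl | h
      exacts [hT, hs T' h]
    have := hle _ hs'
    rw [Finset.card_insert_of_notMem hTs] at this
    have := Finset.card_le_card (hmaps _ hs')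
    omega
  · have hnodup : g.roots.Nodup := by
      refine Multiset.toFinset_card_eq_card_iff_nodup.mp (le_antisymm
        (Multiset.toFinset_card_le _) ?_)
      rw [← himage, hNcard, ← hdeg]
      exact card_roots' _
    have hspl := (IsAlgClosed.splits g).eq_prod_roots
    rw [W.leadingCoeff_preΨ hpF, if_neg hodd] at hspl
    rw [himage, Finset.prod, Multiset.toFinset_val, hnodup.dedup]
    simpa using hspl
  · intro r hr
    refine le_antisymm (card_xCoord_fibre_le s (fun T hT ↦ (hs T hT).1) r) ?_
    by_contra! hlt
    have hsum := Finset.card_eq_sum_card_image xCoord s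
    have : ∑ x ∈ s.image xCoord, (s.filter fun P ↦ xCoord P = x).card <
        ∑ x ∈ s.image xCoord, 2 :=
      Finset.sum_lt_sum (fun x _ ↦ card_xCoord_fibre_le s (fun T hT ↦ (hs T hT).1) x) ⟨r, hr, hlt⟩
    rw [Finset.sum_const, smul_eq_mul] at this
    omega

end IsAlgClosed

end WeierstrassCurve
end Torsion

/-! ### Combinatorics of an abstract valuation on p-primary torsion. -/

section TorsionNorm

/-- An abstract version of the valuation on the `p`-primary torsion of a supersingular formal group:
`S` is the set of nonzero `p`-torsion points. -/
structure TorsionNorm (p : ℕ) (G : Type*) [AddCommGroup G] where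
  /-- the nonzero `p`-torsion -/
  S : Finset G
  /-- the valuation -/
  h : G → ℝ
  prime : p.Prime
  mem_S : ∀ T, T ∈ S ↔ T ≠ 0 ∧ p • T = 0
  card_S : S.card = p ^ 2 - 1
  h_pos : ∀ T ∈ S, 0 < h T
  h_neg : ∀ P, h (-P) = h P
  h_add : ∀ P Q, (∃ n, p ^ n • P = 0) → (∃ n, p ^ n • Q = 0) → P ≠ 0 → Q ≠ 0 → P + Q ≠ 0 →
    min (h P) (h Q) ≤ h (P + Q)
  sum_S : ∑ T ∈ S, h T = 1
  h_smul : ∀ P, (∃ n, p ^ n • P = 0) → p • P ≠ 0 → h (p • P) = h P + ∑ T ∈ S, h (P + T)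

namespace TorsionNorm

variable {p : ℕ} {G : Type*} [AddCommGroup G] (N : TorsionNorm p G)
include N

lemma one_lt_p : (1 : ℝ) < p := by exact_mod_cast N.prime.one_lt

lemma card_S_real : (N.S.card : ℝ) = (p : ℝ) ^ 2 - 1 := by
  rw [N.card_S, Nat.cast_sub (Nat.pow_pos N.prime.pos)]
  push_cast
  ring

lemma primary_of_mem {n : ℕ} {P : G} (hP : p ^ n • P ∈ N.S) : ∃ k, p ^ k • P = 0 :=
  ⟨n + 1, by rw [pow_succ', mul_smul, ((N.mem_S _).mp hP).2]⟩

lemma primary_of_mem_S {T : G} (hT : T ∈ N.S) : ∃ k, p ^ k • T = 0 :=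
  ⟨1, by rw [pow_one, ((N.mem_S _).mp hT).2]⟩

/-- In every fibre of multiplication by `p` there is a point of maximal valuation; it determines the
valuations of all the other points. -/
lemma exists_max {P : G} (hP : ∃ n, p ^ n • P = 0) (hpP : p • P ≠ 0) :
    ∃ P₀, p • P₀ = p • P ∧ (∀ T ∈ N.S, N.h (P₀ + T) = min (N.h P₀) (N.h T)) ∧
      N.h (p • P) = N.h P₀ + ∑ T ∈ N.S, min (N.h P₀) (N.h T) := by
  obtain ⟨P₀, hP₀, hmax⟩ := Finset.exists_max_image (insert P (N.S.image (P + ·))) N.h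
    (Finset.insert_nonempty _ _)
  have hmem : ∀ Q, Q ∈ insert P (N.S.image (P + ·)) ↔ p • Q = p • P := by
    intro Q
    rw [Finset.mem_insert, Finset.mem_image]
    constructor
    · rintro (rfl | ⟨T, hT, rfl⟩)
      · rfl
      · rw [smul_add, ((N.mem_S T).mp hT).2, add_zero]
    · intro hQ
      by_cases h0 : Q = P
      · exact Or.inl h0
      · exact Or.inr ⟨Q - P, (N.mem_S _).mpr ⟨sub_ne_zero.mpr h0, by rw [smul_sub, hQ, sub_self]⟩,
          by abel⟩
  have hpP₀ := (hmem P₀).mp hP₀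
  have hP₀0 : P₀ ≠ 0 := fun h0 ↦ hpP (by rw [← hpP₀, h0, smul_zero])
  have hprim : ∃ n, p ^ n • P₀ = 0 := by
    obtain ⟨n, hn⟩ := hP
    refine ⟨n + 1, ?_⟩
    rw [pow_succ, mul_smul, hpP₀, ← mul_smul, mul_comm, mul_smul, hn, smul_zero]
  have hT : ∀ T ∈ N.S, N.h (P₀ + T) = min (N.h P₀) (N.h T) := by
    intro T hT
    obtain ⟨hT0, hpT⟩ := (N.mem_S T).mp hT
    have hp' : p • (P₀ + T) = p • P := by rw [smul_add, hpT, add_zero, hpP₀]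
    have hne : P₀ + T ≠ 0 := fun h0 ↦ hpP (by rw [← hp', h0, smul_zero])
    have hle := hmax _ ((hmem (P₀ + T)).mpr hp')
    have hge := N.h_add P₀ T hprim (N.primary_of_mem_S hT) hP₀0 hT0 hne
    rcases lt_or_ge (N.h T) (N.h P₀) with hlt | hlt
    · have hprim' : ∃ n, p ^ n • (P₀ + T) = 0 := by
        obtain ⟨n, hn⟩ := hprim
        refine ⟨n + 1, ?_⟩
        rw [smul_add, pow_succ, mul_smul, mul_smul, hpT, smul_comm (p ^ n) p P₀, hn]
        simp
      -- When h(T) < h(P₀), writing T = (P₀ + T) - P₀ forces equality in the ultrametric inequality.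
      -- Otherwise maximality of h(P₀) does.
      have := N.h_add (P₀ + T) (-P₀) hprim'
        (by obtain ⟨n, hn⟩ := hprim; exact ⟨n, by rw [smul_neg, hn, neg_zero]⟩) hne
        (neg_ne_zero.mpr hP₀0) (by rwa [show P₀ + T + -P₀ = T by abel])
      rw [show P₀ + T + -P₀ = T by abel, N.h_neg] at this
      rw [min_eq_right hlt.le] at hge ⊢
      rcases min_le_iff.mp this with h | h
      · exact le_antisymm h hge
      · exact absurd h (not_le.mpr hlt)
    · rw [min_eq_left hlt] at hge ⊢
      exact le_antisymm hle hge
  refine ⟨P₀, hpP₀, hT, ?_⟩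
  rw [← hpP₀, N.h_smul P₀ hprim (hpP₀ ▸ hpP), Finset.sum_congr rfl hT]

lemma eq_or_mem_of_smul_eq {P P₀ : G} (h : p • P₀ = p • P) :
    P = P₀ ∨ ∃ T ∈ N.S, P = P₀ + T := by
  by_cases h0 : P = P₀
  · exact Or.inl h0
  · exact Or.inr ⟨P - P₀, (N.mem_S _).mpr ⟨sub_ne_zero.mpr h0, by rw [smul_sub, h, sub_self]⟩,
      by abel⟩

section Constant

variable (hc : ∀ T ∈ N.S, N.h T = 1 / ((p : ℝ) ^ 2 - 1))
include hc

lemma h_of_constant (n : ℕ) (P : G) (hP : p ^ n • P ∈ N.S) :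
    N.h P = 1 / ((p : ℝ) ^ 2 - 1) / (p : ℝ) ^ (2 * n) := by
  have hp := N.one_lt_p
  set e := 1 / ((p : ℝ) ^ 2 - 1) with he
  have hp2 : 0 < (p : ℝ) ^ 2 - 1 := by nlinarith
  have he0 : 0 < e := by positivity
  induction n generalizing P with
  | zero => rw [pow_zero, one_smul] at hP; simp [hc P hP]
  | succ n ih =>
    have hQ : p ^ n • p • P ∈ N.S := by rwa [← mul_smul, ← pow_succ]
    have hQ0 : p • P ≠ 0 := fun h0 ↦ ((N.mem_S _).mp hQ).1 (by rw [h0, smul_zero])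
    have hIH := ih _ hQ
    have hle : N.h (p • P) ≤ e := by
      rw [hIH]
      exact div_le_self he0.le (one_le_pow₀ hp.le)
    obtain ⟨P₀, hpP₀, hT, hsum⟩ := N.exists_max (N.primary_of_mem hP) hQ0
    rw [Finset.sum_congr rfl fun T hT ↦ by rw [hc T hT], Finset.sum_const, nsmul_eq_mul,
      N.card_S_real] at hsum
    -- If h(P₀) ≥ e, the sum rule gives h(pP) = h(P₀) + 1, contradicting h(pP) ≤ e. So h is constant
    -- on the fibre, equal to h(pP)/p^2.
    rcases le_or_gt e (N.h P₀) with hr | hr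
    · rw [min_eq_right hr] at hsum
      have : ((p : ℝ) ^ 2 - 1) * e > 0 := by positivity
      linarith
    · rw [min_eq_left hr.le] at hsum
      have hPr : N.h P = N.h P₀ := by
        rcases N.eq_or_mem_of_smul_eq hpP₀ with rfl | ⟨T, hTS, rfl⟩
        · rfl
        · rw [hT T hTS, hc T hTS, min_eq_left hr.le]
      rw [hPr, mul_add, pow_add, mul_one]
      have : N.h P₀ * (p : ℝ) ^ 2 = e / (p : ℝ) ^ (2 * n) := by linarith
      rw [← div_div, ← this]
      field_simp

end Constant

/-- A canonical subgroup, with the two valuations of nonzero `p`-torsion points. -/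
structure HasBreak (K : AddSubgroup G) (α β : ℝ) : Prop where
  lt : β < α
  pos : 0 < β
  sub : ∀ T ∈ K, T ≠ 0 → T ∈ N.S
  h_mem : ∀ T ∈ N.S, T ∈ K → N.h T = α
  h_not_mem : ∀ T ∈ N.S, T ∉ K → N.h T = β
  card_mem : (N.S.filter (· ∈ K)).card = p - 1
  card_not_mem : (N.S.filter (· ∉ K)).card = p ^ 2 - p
  sum : ((p : ℝ) - 1) * α + ((p : ℝ) ^ 2 - p) * β = 1
  eq_zmultiples : ∀ T ∈ N.S, T ∈ K → K = AddSubgroup.zmultiples T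

lemma h_le_h_nsmul {T : G} (hT : T ∈ N.S) (k : ℕ) (hk : k • T ≠ 0) : N.h T ≤ N.h (k • T) := by
  induction k with
  | zero => exact absurd (zero_smul _ _) hk
  | succ k ih =>
    have hT' := (N.mem_S T).mp hT
    by_cases h0 : k • T = 0
    · rw [succ_nsmul, h0, zero_add]
    · rw [succ_nsmul] at hk ⊢
      refine (le_min (ih h0) le_rfl).trans (N.h_add _ _ ⟨1, ?_⟩ (N.primary_of_mem_S hT) h0 hT'.1 hk)
      rw [pow_one, ← mul_smul, mul_comm, mul_smul, hT'.2, smul_zero]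

lemma addOrderOf_eq {T : G} (hT : T ∈ N.S) : addOrderOf T = p := by
  have := Fact.mk N.prime
  exact addOrderOf_eq_prime ((N.mem_S T).mp hT).2 ((N.mem_S T).mp hT).1

lemma h_le_of_mem_zmultiples {T R : G} (hT : T ∈ N.S) (hR : R ∈ N.S)
    (h : T ∈ AddSubgroup.zmultiples R) : N.h R ≤ N.h T := by
  have hfin : IsOfFinAddOrder R := addOrderOf_pos_iff.mp
    (by rw [N.addOrderOf_eq hR]; exact N.prime.pos)
  obtain ⟨k, rfl⟩ := hfin.mem_multiples_iff_mem_zmultiples.mpr h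
  exact N.h_le_h_nsmul hR k ((N.mem_S _).mp hT).1

/-- By the ultrametric inequality, 0 and the torsion points with h above the minimum β form a
subgroup of the p-torsion, which has order p^2. If h is not constant, this subgroup is neither zero
nor everything, so it has order p. Any two nonzero elements are then multiples of each other, hence
have the same h. -/
lemma constant_or_hasBreak :
    (∀ T ∈ N.S, N.h T = 1 / ((p : ℝ) ^ 2 - 1)) ∨ ∃ K α β, N.HasBreak K α β := by
  have hp := N.prime
  have hpr := N.one_lt_p
  have hp2 : 0 < (p : ℝ) ^ 2 - 1 := by nlinarith
  have hpp : p < p ^ 2 := by nlinarith [hp.one_lt]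
  have hS : N.S.Nonempty := Finset.card_pos.mp (by rw [N.card_S]; have := hp.one_lt; omega)
  obtain ⟨T₀, hT₀, hmin⟩ := Finset.exists_min_image N.S N.h hS
  set β := N.h T₀ with hβ
  by_cases hall : ∀ T ∈ N.S, N.h T = β
  · left
    have hsum := N.sum_S
    rw [Finset.sum_congr rfl hall, Finset.sum_const, nsmul_eq_mul, N.card_S_real] at hsum
    intro T hT
    rw [hall T hT, eq_div_iff hp2.ne']
    linarith
  right
  push Not at hall
  obtain ⟨R, hR, hRβ⟩ := hall
  have hRβ : β < N.h R := lt_of_le_of_ne (hmin R hR) hRβ.symm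
  let E : AddSubgroup G := (DistribSMul.toAddMonoidHom G p).ker
  have hE : ∀ T, T ∈ E ↔ p • T = 0 := fun T ↦ AddMonoidHom.mem_ker
  let K : AddSubgroup G :=
    { carrier := {T | T = 0 ∨ (T ∈ N.S ∧ β < N.h T)}
      zero_mem' := Or.inl rfl
      neg_mem' := by
        rintro T (rfl | ⟨hT, h⟩)
        · exact Or.inl neg_zero
        · refine Or.inr ⟨(N.mem_S _).mpr ?_, by rwa [N.h_neg]⟩
          have := (N.mem_S T).mp hT
          exact ⟨neg_ne_zero.mpr this.1, by rw [smul_neg, this.2, neg_zero]⟩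
      add_mem' := by
        rintro T T' (rfl | ⟨hT, h⟩) (rfl | ⟨hT', h'⟩)
        · exact Or.inl (add_zero _)
        · exact Or.inr ⟨by rwa [zero_add], by rwa [zero_add]⟩
        · exact Or.inr ⟨by rwa [add_zero], by rwa [add_zero]⟩
        · by_cases h0 : T + T' = 0
          · exact Or.inl h0
          · have a := (N.mem_S T).mp hT
            have a' := (N.mem_S T').mp hT'
            exact Or.inr ⟨(N.mem_S _).mpr ⟨h0, by rw [smul_add, a.2, a'.2, add_zero]⟩,
              (lt_min h h').trans_le (N.h_add _ _ (N.primary_of_mem_S hT) (N.primary_of_mem_S hT')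
                a.1 a'.1 h0)⟩ }
  have hK : ∀ T, T ∈ K ↔ T = 0 ∨ (T ∈ N.S ∧ β < N.h T) := fun T ↦ Iff.rfl
  have hKE : K ≤ E := by
    rintro T (rfl | ⟨hT, -⟩)
    · exact zero_mem _
    · exact (hE T).mpr ((N.mem_S T).mp hT).2
  have hEset : (E : Set G) = (insert 0 N.S : Finset G) := by
    ext T
    simp only [SetLike.mem_coe, hE, Finset.coe_insert, Set.mem_insert_iff, N.mem_S]
    by_cases h0 : T = 0 <;> simp [h0]
  have h0S : (0 : G) ∉ N.S := fun h ↦ ((N.mem_S 0).mp h).1 rfl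
  have hEcard : Nat.card E = p ^ 2 := by
    have : Nat.card (E : Set G) = p ^ 2 := by
      rw [hEset, Nat.card_eq_card_toFinset, Finset.toFinset_coe, Finset.card_insert_of_notMem h0S,
        N.card_S]
      omega
    exact this
  have hKset : (K : Set G) = (insert 0 (N.S.filter (· ∈ K)) : Finset G) := by
    ext T
    simp only [SetLike.mem_coe, Finset.coe_insert, Set.mem_insert_iff, Finset.mem_filter, hK]
    tauto
  have hKcard' : Nat.card K = (N.S.filter (· ∈ K)).card + 1 := by
    have : Nat.card (K : Set G) = (N.S.filter (· ∈ K)).card + 1 := by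
      rw [hKset, Nat.card_eq_card_toFinset, Finset.toFinset_coe, Finset.card_insert_of_notMem]
      simp [h0S]
    exact this
  have hcards := Finset.card_filter_add_card_filter_not (s := N.S) (· ∈ K)
  have hKcard : Nat.card K = p := by
    have hdvd := AddSubgroup.card_dvd_of_le hKE
    rw [hEcard, Nat.dvd_prime_pow hp] at hdvd
    obtain ⟨i, hi, hcard⟩ := hdvd
    interval_cases i
    · have : 0 < (N.S.filter (· ∈ K)).card :=
        Finset.card_pos.mpr ⟨R, Finset.mem_filter.mpr ⟨hR, Or.inr ⟨hR, hRβ⟩⟩⟩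
      rw [pow_zero] at hcard
      omega
    · rw [hcard, pow_one]
    · have : 0 < (N.S.filter (· ∉ K)).card :=
        Finset.card_pos.mpr ⟨T₀, Finset.mem_filter.mpr ⟨hT₀, fun h ↦
          h.elim (fun h ↦ h0S (h ▸ hT₀)) fun h ↦ lt_irrefl _ h.2⟩⟩
      have := N.card_S
      omega
  have hz : ∀ T ∈ N.S, T ∈ K → K = AddSubgroup.zmultiples T := by
    intro T hT hTK
    have : Finite K := Nat.finite_of_card_ne_zero (by rw [hKcard]; exact hp.ne_zero)
    symm
    refine AddSubgroup.eq_of_le_of_card_ge ((AddSubgroup.zmultiples_le_of_mem hTK)) ?_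
    rw [hKcard, Nat.card_zmultiples, N.addOrderOf_eq hT]
  have hRK : R ∈ K := Or.inr ⟨hR, hRβ⟩
  have hc1 : (N.S.filter (· ∈ K)).card = p - 1 := by omega
  have hc2 : (N.S.filter (· ∉ K)).card = p ^ 2 - p := by
    have := N.card_S
    have := hp.one_lt
    omega
  have hα : ∀ T ∈ N.S, T ∈ K → N.h T = N.h R := fun T hT hTK ↦
    le_antisymm (N.h_le_of_mem_zmultiples hR hT (hz T hT hTK ▸ hRK))
      (N.h_le_of_mem_zmultiples hT hR (hz R hR hRK ▸ hTK))
  have hβ' : ∀ T ∈ N.S, T ∉ K → N.h T = β := fun T hT hTK ↦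
    le_antisymm (not_lt.mp fun h ↦ hTK (Or.inr ⟨hT, h⟩)) (hmin T hT)
  refine ⟨K, N.h R, β, ⟨hRβ, N.h_pos _ hT₀, fun T hT h0 ↦ (hT.resolve_left h0).1, hα, hβ',
    hc1, hc2, ?_, hz⟩⟩
  have hsum := N.sum_S
  rw [← Finset.sum_filter_add_sum_filter_not N.S (· ∈ K),
    Finset.sum_congr rfl (fun T hT ↦ hα T (Finset.mem_filter.mp hT).1 (Finset.mem_filter.mp hT).2),
    Finset.sum_congr rfl (fun T hT ↦ hβ' T (Finset.mem_filter.mp hT).1 (Finset.mem_filter.mp hT).2),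
    Finset.sum_const, Finset.sum_const, hc1, hc2, nsmul_eq_mul, nsmul_eq_mul,
    Nat.cast_sub hp.one_le, Nat.cast_sub hpp.le] at hsum
  push_cast at hsum
  exact hsum

section Break

variable {N} {K : AddSubgroup G} {α β : ℝ} (hB : N.HasBreak K α β)
include hB

lemma HasBreak.sum_min (r : ℝ) : ∑ T ∈ N.S, min r (N.h T) =
    ((p : ℝ) - 1) * min r α + ((p : ℝ) ^ 2 - p) * min r β := by
  have hp := N.prime
  have hpp : p ≤ p ^ 2 := by nlinarith [hp.one_lt]
  have h₁ : ∑ T ∈ N.S with T ∈ K, min r (N.h T) = ∑ T ∈ N.S with T ∈ K, min r α :=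
    Finset.sum_congr rfl fun T hT ↦ by
      rw [hB.h_mem T (Finset.mem_filter.mp hT).1 (Finset.mem_filter.mp hT).2]
  have h₂ : ∑ T ∈ N.S with T ∉ K, min r (N.h T) = ∑ T ∈ N.S with T ∉ K, min r β :=
    Finset.sum_congr rfl fun T hT ↦ by
      rw [hB.h_not_mem T (Finset.mem_filter.mp hT).1 (Finset.mem_filter.mp hT).2]
  rw [← Finset.sum_filter_add_sum_filter_not N.S (· ∈ K), h₁, h₂,
    Finset.sum_const, Finset.sum_const, hB.card_mem, hB.card_not_mem, nsmul_eq_mul, nsmul_eq_mul,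
    Nat.cast_sub hp.one_le, Nat.cast_sub hpp]
  push_cast
  rfl

/-- The valuations in a fibre of multiplication by `p`. -/
lemma HasBreak.fibre {P : G} (hP : ∃ n, p ^ n • P = 0) (hpP : p • P ≠ 0)
    (hα : N.h (p • P) ≤ α) :
    (N.h (p • P) ≤ (p : ℝ) ^ 2 * β ∧ N.h P = N.h (p • P) / (p : ℝ) ^ 2) ∨
    ((p : ℝ) ^ 2 * β < N.h (p • P) ∧ ∃ r, r = (N.h (p • P) - ((p : ℝ) ^ 2 - p) * β) / p ∧
      β < r ∧ (N.h P = β ∨ N.h P = r) ∧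
      {P' : G | p • P' = p • P ∧ N.h P' = r}.ncard = p ∧
      {P' : G | p • P' = p • P ∧ N.h P' = β}.ncard = p ^ 2 - p) := by
  -- Put r = h(P₀). If r ≤ β, the sum rule gives h(pP) = p^2 r and h is constant on the fibre. If β
  -- < r < α, it gives h(pP) = p r + (p^2-p)β, with value r on P₀ + K and β on the rest. If r ≥ α,
  -- it gives h(pP) = r + 1 > α, which is excluded.
  have hp := N.one_lt_p
  obtain ⟨P₀, hpP₀, hT, hsum⟩ := N.exists_max hP hpP
  rw [hB.sum_min] at hsum
  have hβ := hB.pos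
  have hlt := hB.lt
  rcases le_or_gt (N.h P₀) β with hr | hr
  · left
    rw [min_eq_left hr, min_eq_left (hr.trans hlt.le)] at hsum
    have hPr : N.h P = N.h P₀ := by
      rcases N.eq_or_mem_of_smul_eq hpP₀ with rfl | ⟨T, hTS, rfl⟩
      · rfl
      · rw [hT T hTS, min_eq_left]
        by_cases hTK : T ∈ K
        · rw [hB.h_mem T hTS hTK]; linarith
        · rw [hB.h_not_mem T hTS hTK]; exact hr
    rw [hPr, eq_div_iff (by positivity)]
    constructor
    · nlinarith
    · linarith
  · right
    have hrα : N.h P₀ < α := by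
      by_contra! h
      rw [min_eq_right h, min_eq_right hr.le] at hsum
      linarith [hB.sum]
    rw [min_eq_left hrα.le, min_eq_right hr.le] at hsum
    have hK : ∀ T ∈ N.S, T ∈ K → N.h (P₀ + T) = N.h P₀ := fun T hTS hTK ↦ by
      rw [hT T hTS, hB.h_mem T hTS hTK, min_eq_left hrα.le]
    have hK' : ∀ T ∈ N.S, T ∉ K → N.h (P₀ + T) = β := fun T hTS hTK ↦ by
      rw [hT T hTS, hB.h_not_mem T hTS hTK, min_eq_right hr.le]
    refine ⟨by nlinarith, N.h P₀, ?_, hr, ?_, ?_, ?_⟩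
    · rw [eq_div_iff (by positivity)]
      linarith
    · rcases N.eq_or_mem_of_smul_eq hpP₀ with rfl | ⟨T, hTS, rfl⟩
      · exact Or.inr rfl
      · by_cases hTK : T ∈ K
        · exact Or.inr (hK T hTS hTK)
        · exact Or.inl (hK' T hTS hTK)
    · have : {P' : G | p • P' = p • P ∧ N.h P' = N.h P₀} =
          (insert P₀ ((N.S.filter (· ∈ K)).image (P₀ + ·)) : Finset G) := by
        ext P'
        simp only [Set.mem_ofPred_eq, Finset.coe_insert, Finset.coe_image, Set.mem_insert_iff,
          Set.mem_image, Finset.mem_coe, Finset.mem_filter]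
        constructor
        · rintro ⟨h1, h2⟩
          rcases N.eq_or_mem_of_smul_eq (hpP₀.trans h1.symm) with rfl | ⟨T, hTS, rfl⟩
          · exact Or.inl rfl
          · refine Or.inr ⟨T, ⟨hTS, ?_⟩, rfl⟩
            by_contra hTK
            rw [hK' T hTS hTK] at h2
            exact hr.ne h2
        · rintro (rfl | ⟨T, ⟨hTS, hTK⟩, rfl⟩)
          · exact ⟨hpP₀, rfl⟩
          · exact ⟨by rw [smul_add, ((N.mem_S T).mp hTS).2, add_zero, hpP₀], hK T hTS hTK⟩
      rw [this, Set.ncard_coe_finset, Finset.card_insert_of_notMem,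
        Finset.card_image_of_injective _ (add_right_injective P₀), hB.card_mem]
      · have := N.prime.one_lt
        omega
      · simp only [Finset.mem_image, Finset.mem_filter, add_eq_left, exists_eq_right]
        exact fun h ↦ ((N.mem_S _).mp h.1).1 rfl
    · have : {P' : G | p • P' = p • P ∧ N.h P' = β} =
          ((N.S.filter (· ∉ K)).image (P₀ + ·) : Finset G) := by
        ext P'
        simp only [Set.mem_ofPred_eq, Finset.coe_image,
          Set.mem_image, Finset.mem_coe, Finset.mem_filter]
        constructor
        · rintro ⟨h1, h2⟩
          rcases N.eq_or_mem_of_smul_eq (hpP₀.trans h1.symm) with rfl | ⟨T, hTS, rfl⟩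
          · exact absurd h2 hr.ne'
          · refine ⟨T, ⟨hTS, fun hTK ↦ ?_⟩, rfl⟩
            rw [hK T hTS hTK] at h2
            exact hr.ne' h2
        · rintro ⟨T, ⟨hTS, hTK⟩, rfl⟩
          exact ⟨by rw [smul_add, ((N.mem_S T).mp hTS).2, add_zero, hpP₀], hK' T hTS hTK⟩
      rw [this, Set.ncard_coe_finset,
        Finset.card_image_of_injective _ (add_right_injective P₀), hB.card_not_mem]

omit hB in
lemma smul_step {n : ℕ} {P : G} (hP : p ^ (n + 1) • P ∈ N.S) :
    p ^ n • p • P ∈ N.S ∧ p • P ≠ 0 := by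
  have hQ : p ^ n • p • P ∈ N.S := by rwa [← mul_smul, ← pow_succ]
  exact ⟨hQ, fun h0 ↦ ((N.mem_S _).mp hQ).1 (by rw [h0, smul_zero])⟩

/-- This keeps the hypothesis of `HasBreak.fibre` true at every level: both branches give a value at
most α from a value at most α. -/
lemma HasBreak.h_le {n : ℕ} {P : G} (hP : p ^ n • P ∈ N.S) : N.h P ≤ α := by
  have hp := N.one_lt_p
  have hβ := hB.pos
  have hlt := hB.lt
  induction n generalizing P with
  | zero =>
    rw [pow_zero, one_smul] at hP
    by_cases hK : P ∈ K
    · exact (hB.h_mem P hP hK).le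
    · exact (hB.h_not_mem P hP hK).trans_le hlt.le
  | succ n ih =>
    obtain ⟨hQ, hQ0⟩ := smul_step hP
    rcases hB.fibre (N.primary_of_mem hP) hQ0 (ih hQ) with ⟨h1, h2⟩ | ⟨-, r, hr, -, h | h, -, -⟩
    · rw [h2, div_le_iff₀ (by positivity)]
      nlinarith
    · rw [h]; exact hlt.le
    · rw [h, hr, div_le_iff₀ (by positivity)]
      have := ih hQ
      nlinarith [mul_pos (mul_pos (sub_pos.mpr hp) (zero_lt_one.trans hp)) hβ]

lemma HasBreak.h_of_smul_le {n : ℕ} {P : G} (hP : p ^ (n + 1) • P ∈ N.S)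
    (h : N.h (p • P) ≤ (p : ℝ) ^ 2 * β) : N.h P = N.h (p • P) / (p : ℝ) ^ 2 := by
  obtain ⟨hQ, hQ0⟩ := smul_step hP
  rcases hB.fibre (N.primary_of_mem hP) hQ0 (hB.h_le hQ) with ⟨-, h2⟩ | ⟨h1, -⟩
  · exact h2
  · exact absurd h (not_le.mpr h1)

/-- Below a point of valuation `β`, the valuation is divided by `p ^ 2` at each step. -/
lemma HasBreak.h_of_smul_eq {n m : ℕ} (hmn : m ≤ n) {P : G} (hP : p ^ n • P ∈ N.S)
    (h : N.h (p ^ m • P) = β) : N.h P = β / (p : ℝ) ^ (2 * m) := by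
  have hp := N.one_lt_p
  have hβ := hB.pos
  induction m generalizing n P with
  | zero => simpa using h
  | succ m ih =>
    obtain ⟨n, rfl⟩ : ∃ k, n = k + 1 := ⟨n - 1, by omega⟩
    obtain ⟨hQ, hQ0⟩ := smul_step hP
    have hIH := ih (by omega) hQ (by rwa [← mul_smul, ← pow_succ])
    rw [hB.h_of_smul_le hP, hIH, div_div, mul_add, pow_add, mul_one]
    rw [hIH]
    have h1 : 1 ≤ (p : ℝ) ^ (2 * m) := one_le_pow₀ hp.le
    have h2 : 1 ≤ (p : ℝ) ^ 2 := one_le_pow₀ hp.le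
    exact (div_le_self hβ.le h1).trans (le_mul_of_one_le_left hβ.le h2)

lemma HasBreak.h_of_not_mem {n : ℕ} {P : G} (hP : p ^ n • P ∈ N.S) (hK : p ^ n • P ∉ K) :
    N.h P = β / (p : ℝ) ^ (2 * n) :=
  hB.h_of_smul_eq le_rfl hP (hB.h_not_mem _ hP hK)

/-- The valuations along a sequence of points that lies over the canonical subgroup and avoids the
valuation `β`. -/
lemma HasBreak.h_of_mem {μ : ℝ} (hμ : μ = ((p : ℝ) ^ 2 - p) * β) {s : ℕ}
    (hs : IsLeast {j : ℕ | 1 / ((p : ℝ) ^ j * (p + 1)) ≤ μ} s) {n : ℕ} {P : G}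
    (hP : p ^ n • P ∈ N.S) (hK : p ^ n • P ∈ K) (hne : ∀ m ≤ n, N.h (p ^ m • P) ≠ β) :
    (n ≤ s → N.h P = (1 - (p : ℝ) ^ n * μ) / ((p : ℝ) ^ n * (p - 1)) ∧
      (1 ≤ n → {P' : G | p • P' = p • P ∧ N.h P' = N.h P}.ncard = p ∧
        {P' : G | p • P' = p • P ∧ N.h P' = β}.ncard = p ^ 2 - p)) ∧
    (s < n → N.h P = (1 - (p : ℝ) ^ s * μ) / ((p : ℝ) ^ s * (p - 1)) / (p : ℝ) ^ (2 * (n - s))) := by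
  have hp := N.one_lt_p
  have hp0 : (0 : ℝ) < p := by linarith
  have hp1 : (0 : ℝ) < p - 1 := by linarith
  have hβ := hB.pos
  -- The fibre splits exactly when the value below exceeds p^2 β. For the value (1 - p^j
  -- μ)/(p^j(p-1)) this means μ < 1/(p^j(p+1)), that is j < s. Hence the larger branch is followed
  -- up to level s, and afterwards every step divides by p^2.
  have hp2β : (p : ℝ) ^ 2 * β = p * μ / (p - 1) := by
    rw [hμ]; field_simp
  induction n generalizing P with
  | zero =>
    rw [pow_zero, one_smul] at hP hK
    refine ⟨fun _ ↦ ⟨?_, fun h ↦ absurd h (by norm_num)⟩, fun h ↦ absurd h (by omega)⟩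
    rw [hB.h_mem P hP hK, pow_zero, one_mul, one_mul, eq_div_iff hp1.ne', hμ]
    linarith [hB.sum]
  | succ n ih =>
    obtain ⟨hQ, hQ0⟩ := smul_step hP
    have hIH := ih hQ (by rwa [← mul_smul, ← pow_succ]) fun m hm ↦ by
      rw [← mul_smul, ← pow_succ]; exact hne (m + 1) (by omega)
    have hfib := hB.fibre (N.primary_of_mem hP) hQ0 (hB.h_le hQ)
    have hbase : (1 - (p : ℝ) ^ s * μ) / ((p : ℝ) ^ s * (p - 1)) ≤ (p : ℝ) ^ 2 * β := by
      have := hs.1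
      rw [Set.mem_ofPred_eq, div_le_iff₀ (by positivity)] at this
      rw [hp2β, div_le_div_iff₀ (by positivity) hp1]
      nlinarith
    constructor
    · intro hns
      have hQe := (hIH.1 (by omega)).1
      have hlt : (p : ℝ) ^ 2 * β < N.h (p • P) := by
        have : n ∉ {j : ℕ | 1 / ((p : ℝ) ^ j * (p + 1)) ≤ μ} := fun h ↦ by
          have := hs.2 h
          omega
        rw [Set.mem_ofPred_eq, not_le, lt_div_iff₀ (by positivity)] at this
        rw [hQe, hp2β, div_lt_div_iff₀ hp1 (by positivity)]
        nlinarith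
      rcases hfib with ⟨h1, -⟩ | ⟨-, r, hr, hrβ, hPr, hc1, hc2⟩
      · exact absurd h1 (not_le.mpr hlt)
      -- In a split fibre P has value β or r; the former is excluded by assumption.
      have hPr := hPr.resolve_left (by simpa using hne 0 (by omega))
      refine ⟨?_, fun _ ↦ ⟨hPr ▸ hc1, hc2⟩⟩
      rw [hPr, hr, hQe, ← hμ]
      field_simp
      ring
    · intro hsn
      have hle : N.h (p • P) ≤ (p : ℝ) ^ 2 * β := by
        rcases Nat.lt_or_ge s n with h | h
        · rw [hIH.2 h]
          rw [div_le_iff₀ (by positivity)]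
          exact hbase.trans (le_mul_of_one_le_right (by positivity) (one_le_pow₀ hp.le))
        · obtain rfl : n = s := by omega
          rw [(hIH.1 le_rfl).1]
          exact hbase
      rw [hB.h_of_smul_le hP hle]
      rcases Nat.lt_or_ge s n with h | h
      · rw [hIH.2 h, div_div, ← pow_add]
        congr 3
        omega
      · obtain rfl : n = s := by omega
        rw [(hIH.1 le_rfl).1, Nat.add_sub_cancel_left, mul_one]

end Break

end TorsionNorm
end TorsionNorm

/-! ### Nonarchimedean estimates for x-coordinates in the kernel of reduction. -/

section Nonarchimedean

namespace AbsoluteValue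

open Polynomial

variable {F : Type*} [Field F] {N : AbsoluteValue F ℝ}

lemma add_eq_left_of_nonarchimedean (hN : IsNonarchimedean N) {a b : F} (h : N b < N a) :
    N (a + b) = N a := by
  rw [hN.add_eq_max_of_ne' N (fun a ↦ (N.map_neg a).symm) h.ne', max_eq_left h.le]

lemma sum_le_of_nonarchimedean (hN : IsNonarchimedean N) {ι : Type*} {s : Finset ι} {f : ι → F}
    {c : ℝ} (hc : 0 ≤ c) (h : ∀ i ∈ s, N (f i) ≤ c) : N (∑ i ∈ s, f i) ≤ c := by
  rcases s.eq_empty_or_nonempty with rfl | hs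
  · simpa using hc
  · obtain ⟨i, hi, hle⟩ := hN.finset_image_add_of_nonempty f hs
    exact hle.trans (h i hi)

lemma sum_lt_of_nonarchimedean (hN : IsNonarchimedean N) {ι : Type*} {s : Finset ι} {f : ι → F}
    {c : ℝ} (hc : 0 < c) (h : ∀ i ∈ s, N (f i) < c) : N (∑ i ∈ s, f i) < c := by
  rcases s.eq_empty_or_nonempty with rfl | hs
  · simpa using hc
  · obtain ⟨i, hi, hle⟩ := hN.finset_image_add_of_nonempty f hs
    exact hle.trans_lt (h i hi)

lemma eval_le_one_of_nonarchimedean (hN : IsNonarchimedean N) {f : F[X]}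
    (hf : ∀ i, N (f.coeff i) ≤ 1) {x : F} (hx : N x ≤ 1) : N (f.eval x) ≤ 1 := by
  rw [eval_eq_sum_range]
  refine sum_le_of_nonarchimedean hN zero_le_one fun i _ ↦ ?_
  rw [map_mul, map_pow]
  exact mul_le_one₀ (hf i) (by positivity) (pow_le_one₀ (N.nonneg x) hx)

lemma eval_eq_pow_of_monic (hN : IsNonarchimedean N) {f : F[X]} (hf : ∀ i, N (f.coeff i) ≤ 1)
    (hm : f.Monic) {x : F} (hx : 1 < N x) : N (f.eval x) = N x ^ f.natDegree := by
  rw [eval_eq_sum_range, Finset.sum_range_succ, add_comm, coeff_natDegree, hm.leadingCoeff, one_mul,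
    ← map_pow]
  refine add_eq_left_of_nonarchimedean hN ?_
  have h0 : 0 < N x := one_pos.trans hx
  refine sum_lt_of_nonarchimedean hN (by rw [map_pow]; positivity) fun i hi ↦ ?_
  rw [map_mul, map_pow, map_pow]
  calc _ ≤ 1 * N x ^ i := by gcongr; exact hf i
    _ < _ := by rw [one_mul]; exact pow_lt_pow_right₀ hx (Finset.mem_range.mp hi)

lemma eval_eq_one_of_coeff (hN : IsNonarchimedean N) {f : F[X]} (h0 : N (f.coeff 0) = 1)
    (hf : ∀ i, 0 < i → N (f.coeff i) < 1) {x : F} (hx : N x ≤ 1) : N (f.eval x) = 1 := by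
  rw [eval_eq_sum_range, Finset.sum_range_succ', pow_zero, mul_one, add_comm,
    add_eq_left_of_nonarchimedean hN, h0]
  rw [h0]
  refine sum_lt_of_nonarchimedean hN one_pos fun i _ ↦ ?_
  rw [map_mul, map_pow]
  exact (mul_le_of_le_one_right (N.nonneg _) (pow_le_one₀ (N.nonneg x) hx)).trans_lt
    (hf _ i.succ_pos)

end AbsoluteValue

namespace WeierstrassCurve

open Polynomial WeierstrassCurve.Affine

variable {F : Type*} [Field F]

/-- A nonarchimedean absolute value for which the Weierstrass equation `W` is integral and its
reduction has no `p`-torsion, so that the `p`-th division polynomial reduces to a unit. -/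
structure IsSupersingularFor (p : ℕ) (W : WeierstrassCurve F) (N : AbsoluteValue F ℝ) : Prop where
  prime : p.Prime
  ne_two : p ≠ 2
  nonarch : IsNonarchimedean N
  integral : ∃ (R : Subring F) (W₀ : WeierstrassCurve R), W₀.map R.subtype = W ∧ ∀ r : R, N r ≤ 1
  norm_pos : 0 < N p
  norm_lt : N p < 1
  coeff_zero : N ((W.preΨ p).coeff 0) = 1
  coeff_lt : ∀ i, 0 < i → N ((W.preΨ p).coeff i) < 1

namespace IsSupersingularFor

variable {p : ℕ} {W : WeierstrassCurve F} {N : AbsoluteValue F ℝ} (H : W.IsSupersingularFor p N)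
include H

lemma norm_le_a : N W.a₁ ≤ 1 ∧ N W.a₂ ≤ 1 ∧ N W.a₃ ≤ 1 ∧ N W.a₄ ≤ 1 ∧ N W.a₆ ≤ 1 := by
  obtain ⟨R, W₀, rfl, h⟩ := H.integral
  exact ⟨h _, h _, h _, h _, h _⟩

lemma norm_le_b : N W.b₂ ≤ 1 ∧ N W.b₄ ≤ 1 ∧ N W.b₆ ≤ 1 ∧ N W.b₈ ≤ 1 := by
  obtain ⟨R, W₀, rfl, h⟩ := H.integral
  rw [map_b₂, map_b₄, map_b₆, map_b₈]
  exact ⟨h _, h _, h _, h _⟩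

lemma norm_coeff_Φ (n : ℤ) (i : ℕ) : N ((W.Φ n).coeff i) ≤ 1 := by
  obtain ⟨R, W₀, rfl, h⟩ := H.integral
  rw [map_Φ, coeff_map]
  exact h _

lemma norm_natCast_le (n : ℕ) : N n ≤ 1 := by
  obtain ⟨R, W₀, rfl, h⟩ := H.integral
  simpa using h n

lemma norm_sum_le {a b : F} {c : ℝ} (ha : N a ≤ c) (hb : N b ≤ c) : N (a + b) ≤ c :=
  (H.nonarch a b).trans (max_le ha hb)

lemma norm_sub_le {a b : F} {c : ℝ} (ha : N a ≤ c) (hb : N b ≤ c) : N (a - b) ≤ c := by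
  rw [sub_eq_add_neg]
  exact H.norm_sum_le ha (by rwa [N.map_neg])

/-- The term x^3 dominates the right side, which forces |y| > |x|, and then y^2 dominates the left
side. -/
lemma norm_y_sq {x y : F} (h : W.toAffine.Equation x y) (hx : 1 < N x) :
    N y ^ 2 = N x ^ 3 := by
  obtain ⟨h1, h2, h3, h4, h6⟩ := H.norm_le_a
  have hx0 : 0 < N x := one_pos.trans hx
  have e := (equation_iff ..).mp h
  have hr : N (x ^ 3 + (W.a₂ * x ^ 2 + W.a₄ * x + W.a₆)) = N x ^ 3 := by
    rw [← map_pow]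
    refine N.add_eq_left_of_nonarchimedean H.nonarch (lt_of_le_of_lt (b := N x ^ 2) ?_ ?_)
    · refine H.norm_sum_le (H.norm_sum_le ?_ ?_) (h6.trans (one_le_pow₀ hx.le))
      · rw [map_mul, map_pow]
        exact mul_le_of_le_one_left (by positivity) h2
      · rw [map_mul]
        exact (mul_le_of_le_one_left hx0.le h4).trans (le_self_pow₀ hx.le two_ne_zero)
    · rw [map_pow]
      exact pow_lt_pow_right₀ hx (by norm_num)
  have hl : N x < N y := by
    by_contra! hyx
    have : N (y ^ 2 + W.a₁ * x * y + W.a₃ * y) ≤ N x ^ 2 := by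
      refine H.norm_sum_le (H.norm_sum_le ?_ ?_) ?_
      · rw [map_pow]; gcongr
      · rw [map_mul, map_mul, sq]
        calc N W.a₁ * N x * N y ≤ 1 * N x * N x := by gcongr
          _ = _ := by ring
      · rw [map_mul]
        calc N W.a₃ * N y ≤ 1 * N x := by gcongr
          _ ≤ _ := by rw [one_mul]; exact le_self_pow₀ hx.le two_ne_zero
    rw [e, show x ^ 3 + W.a₂ * x ^ 2 + W.a₄ * x + W.a₆ =
      x ^ 3 + (W.a₂ * x ^ 2 + W.a₄ * x + W.a₆) by ring, hr] at this
    exact absurd this (not_le.mpr (pow_lt_pow_right₀ hx (by norm_num)))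
  have hy0 : 0 < N y := hx0.trans hl
  rw [← hr, ← map_pow, show x ^ 3 + (W.a₂ * x ^ 2 + W.a₄ * x + W.a₆) =
    y ^ 2 + (W.a₁ * x * y + W.a₃ * y) by linear_combination -e]
  refine (N.add_eq_left_of_nonarchimedean H.nonarch (lt_of_le_of_lt (b := N x * N y) ?_ ?_)).symm
  · refine H.norm_sum_le ?_ ?_
    · rw [map_mul, map_mul]
      calc N W.a₁ * N x * N y ≤ 1 * N x * N y := by gcongr
        _ = _ := by ring
    · rw [map_mul]
      gcongr
      exact h3.trans hx.le
  · rw [map_pow, sq]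
    gcongr

/-- The term (x(P)x(Q))^2 strictly dominates the formula for the product x(P+Q)x(P-Q). Multiplied
over torsion Q, this exact identity gives the sum rule for [p]. -/
lemma norm_add_mul_norm_sub {P Q : W.toAffine.Point} (hP : 1 < N (xCoord P))
    (hQ : 1 < N (xCoord Q)) (hP0 : P ≠ 0) (hQ0 : Q ≠ 0) (hne : xCoord P ≠ xCoord Q) :
    N (xCoord (P + Q)) * N (xCoord (P - Q)) * N (xCoord P - xCoord Q) ^ 2 =
      (N (xCoord P) * N (xCoord Q)) ^ 2 := by
  obtain ⟨-, h4, h6, h8⟩ := H.norm_le_b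
  have e := xCoord_add_mul_xCoord_sub hP0 hQ0 hne
  rw [← map_mul, ← map_mul, ← map_pow, ← map_pow, ← map_mul, e]
  set x := xCoord P
  set y := xCoord Q
  have hx0 : 0 < N x := one_pos.trans hP
  have hy0 : 0 < N y := one_pos.trans hQ
  rw [show (x * y) ^ 2 - W.b₄ * x * y - W.b₆ * (x + y) - W.b₈ = (x * y) ^ 2 +
    (-(W.b₄ * x * y) - W.b₆ * (x + y) - W.b₈) by ring]
  have hxy : 1 < N x * N y := one_lt_mul hP.le hQ
  have hxle : N x ≤ N x * N y := le_mul_of_one_le_right hx0.le hQ.le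
  have hyle : N y ≤ N x * N y := le_mul_of_one_le_left hy0.le hP.le
  refine N.add_eq_left_of_nonarchimedean H.nonarch (lt_of_le_of_lt (b := N x * N y) ?_ ?_)
  · refine H.norm_sub_le (H.norm_sub_le ?_ ?_) (h8.trans hxy.le)
    · rw [N.map_neg, map_mul, map_mul]
      calc N W.b₄ * N x * N y ≤ 1 * N x * N y := by gcongr
        _ = _ := by ring
    · rw [map_mul]
      exact (mul_le_of_le_one_left (N.nonneg _) h6).trans (H.norm_sum_le hxle hyle)
  · rw [map_pow, map_mul]
    exact lt_self_pow₀ hxy (by norm_num)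

lemma norm_add_ge_of_le {P Q : W.toAffine.Point} (hPQ : N (xCoord Q) ≤ N (xCoord P))
    (hQ : 1 < N (xCoord Q)) (hP0 : P ≠ 0) (hQ0 : Q ≠ 0) (hne : xCoord P ≠ xCoord Q) :
    N (xCoord Q) ≤ N (xCoord (P + Q)) ∧ N (xCoord Q) ≤ N (xCoord (P - Q)) := by
  obtain ⟨h2, h4, h6, -⟩ := H.norm_le_b
  have hP := hQ.trans_le hPQ
  have e := H.norm_add_mul_norm_sub hP hQ hP0 hQ0 hne
  have e' := congrArg N (xCoord_add_add_xCoord_sub hP0 hQ0 hne)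
  rw [map_mul, map_pow] at e'
  have hD : 0 < N (xCoord P - xCoord Q) := N.pos (sub_ne_zero.mpr hne)
  have hD' : N (xCoord P - xCoord Q) ≤ N (xCoord P) := H.norm_sub_le le_rfl hPQ
  set x := xCoord P
  set y := xCoord Q
  set u := xCoord (P + Q)
  set u' := xCoord (P - Q)
  have hx0 : 0 < N x := one_pos.trans hP
  have hy0 : 0 < N y := one_pos.trans hQ
  have hs : N (u + u') * N (x - y) ^ 2 ≤ N x ^ 2 * N y := by
    rw [e']
    have hN2 : N 2 ≤ 1 := by simpa using H.norm_natCast_le 2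
    have hxy : N (x + y) ≤ N x := H.norm_sum_le le_rfl hPQ
    have h1 : N x ≤ N x ^ 2 * N y := by
      nlinarith [mul_pos hx0 hy0, mul_pos hx0 (sub_pos.mpr hP), mul_pos hx0 (sub_pos.mpr hQ)]
    refine H.norm_sum_le (H.norm_sum_le (H.norm_sum_le ?_ ?_) ?_) ?_
    · rw [map_mul, map_mul, map_mul]
      calc N 2 * N x * N y * N (x + y) ≤ 1 * N x * N y * N x := by gcongr
        _ = _ := by ring
    · rw [map_mul, map_mul]
      calc N W.b₂ * N x * N y ≤ N x * N x * N y := by gcongr; exact h2.trans hP.le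
        _ = _ := by ring
    · rw [map_mul]
      calc N W.b₄ * N (x + y) ≤ 1 * N x := by gcongr
        _ ≤ _ := by rwa [one_mul]
    · exact (h6.trans hP.le).trans h1
  -- If |v| < |y|, the product forces |v'||x-y|^2 > |x|^2|y|. As |x-y| ≤ |x|, this gives |v'| > |y|
  -- > |v|, so |v+v'| = |v'| violates the bound on the sum.
  have key : ∀ v v' : F, N v * N v' * N (x - y) ^ 2 = (N x * N y) ^ 2 →
      N (v + v') * N (x - y) ^ 2 ≤ N x ^ 2 * N y → N y ≤ N v := by
    intro v v' h1 h2
    by_contra! hlt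
    have hM : 0 < N v' * N (x - y) ^ 2 := by
      refine lt_of_le_of_ne (by positivity) fun h0 ↦ ?_
      rw [mul_assoc, ← h0, mul_zero] at h1
      exact (by positivity : 0 < (N x * N y) ^ 2).ne h1
    have h3 : N x ^ 2 * N y < N v' * N (x - y) ^ 2 := by
      refine lt_of_mul_lt_mul_left ?_ hy0.le
      calc N y * (N x ^ 2 * N y) = N v * (N v' * N (x - y) ^ 2) := by linear_combination -h1
        _ < _ := by gcongr
    have h4 : N v' ≤ N y := by
      by_contra! hgt
      rw [add_comm, N.add_eq_left_of_nonarchimedean H.nonarch (hlt.trans hgt)] at h2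
      exact absurd h2 (not_le.mpr h3)
    have : N v' * N (x - y) ^ 2 ≤ N y * N x ^ 2 := by gcongr
    nlinarith
  exact ⟨key u u' e hs, key u' u (by rw [← e]; ring) (by rwa [add_comm])⟩

/-- Doubling escapes the chord formulas. Here the numerator of x(2P) has absolute value |x|^4 and
the denominator at most |x|^3. -/
lemma norm_two_nsmul_ge {P : W.toAffine.Point} (hP : 1 < N (xCoord P)) (h2 : P + P ≠ 0) :
    N (xCoord P) ≤ N (xCoord (P + P)) := by
  obtain ⟨hb2, h4, h6, h8⟩ := H.norm_le_b
  rw [← two_nsmul] at h2 ⊢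
  rcases P with _ | ⟨x, y, h⟩
  · exact absurd (smul_zero 2) h2
  have hψ := mt (two_nsmul_eq_zero_iff h).mpr h2
  have e := congrArg N (xCoord_two_nsmul h hψ)
  have e' := eval_Ψ₂Sq_of_equation h.1
  change N x ≤ _
  change 1 < N x at hP
  have hx0 : 0 < N x := one_pos.trans hP
  have hN2 : N 2 ≤ 1 := by simpa using H.norm_natCast_le 2
  have hN4 : N 4 ≤ 1 := by simpa using H.norm_natCast_le 4
  have h13 : N x ≤ N x ^ 3 := le_self_pow₀ hP.le (by norm_num)
  have h23 : N x ^ 2 ≤ N x ^ 3 := pow_le_pow_right₀ hP.le (by norm_num)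
  have hle : N ((2 * y + W.a₁ * x + W.a₃) ^ 2) ≤ N x ^ 3 := by
    rw [← e']
    simp only [Ψ₂Sq, eval_add, eval_mul, eval_C, eval_pow, eval_X]
    refine H.norm_sum_le (H.norm_sum_le (H.norm_sum_le ?_ ?_) ?_) ?_
    · rw [map_mul, map_pow]
      exact mul_le_of_le_one_left (by positivity) hN4
    · rw [map_mul, map_pow]
      exact (mul_le_of_le_one_left (by positivity) hb2).trans h23
    · rw [map_mul, map_mul]
      exact (mul_le_of_le_one_left (by positivity)
        (mul_le_one₀ hN2 (N.nonneg _) h4)).trans h13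
    · exact h6.trans (one_le_pow₀ hP.le)
  have hnum : N (x ^ 4 - W.b₄ * x ^ 2 - 2 * W.b₆ * x - W.b₈) = N x ^ 4 := by
    rw [show x ^ 4 - W.b₄ * x ^ 2 - 2 * W.b₆ * x - W.b₈ =
      x ^ 4 + (-(W.b₄ * x ^ 2) - 2 * W.b₆ * x - W.b₈) by ring, ← map_pow]
    refine N.add_eq_left_of_nonarchimedean H.nonarch (lt_of_le_of_lt (b := N x ^ 3) ?_ ?_)
    · refine H.norm_sub_le (H.norm_sub_le ?_ ?_) (h8.trans (one_le_pow₀ hP.le))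
      · rw [N.map_neg, map_mul, map_pow]
        exact (mul_le_of_le_one_left (by positivity) h4).trans h23
      · rw [map_mul, map_mul]
        exact (mul_le_of_le_one_left (by positivity)
          (mul_le_one₀ hN2 (N.nonneg _) h6)).trans h13
    · rw [map_pow]
      exact pow_lt_pow_right₀ hP (by norm_num)
  rw [map_mul, hnum] at e
  by_contra! hlt
  have h0 : 0 < N ((2 * y + W.a₁ * x + W.a₃) ^ 2) := N.pos (pow_ne_zero _ hψ)
  have : N (xCoord (2 • Point.some x y h)) * N ((2 * y + W.a₁ * x + W.a₃) ^ 2) <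
      N x * N x ^ 3 := mul_lt_mul_of_lt_of_le_of_pos_of_nonneg hlt hle h0 hx0.le
  rw [e] at this
  exact this.ne (by ring)

lemma norm_add_ge {P Q : W.toAffine.Point} (hP : 1 < N (xCoord P)) (hQ : 1 < N (xCoord Q))
    (hP0 : P ≠ 0) (hQ0 : Q ≠ 0) (h0 : P + Q ≠ 0) :
    min (N (xCoord P)) (N (xCoord Q)) ≤ N (xCoord (P + Q)) := by
  by_cases hne : xCoord P = xCoord Q
  · rcases (xCoord_eq_iff hP0 hQ0).mp hne with rfl | rfl
    · rw [min_self]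
      exact H.norm_two_nsmul_ge hP h0
    · exact absurd (neg_add_cancel Q) h0
  · rcases le_total (N (xCoord Q)) (N (xCoord P)) with h | h
    · exact (min_le_right _ _).trans (H.norm_add_ge_of_le h hQ hP0 hQ0 hne).1
    · rw [add_comm]
      exact (min_le_left _ _).trans (H.norm_add_ge_of_le h hP hQ0 hP0 (Ne.symm hne)).1

end IsSupersingularFor
end WeierstrassCurve
end Nonarchimedean

/-! ### The valuation on p-primary torsion satisfies the abstract axioms. -/

section SupersingularTorsion

namespace WeierstrassCurve

open Polynomial WeierstrassCurve.Affine

variable {F : Type*} [Field F]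

lemma nsmul_ne_zero_of_primary {G : Type*} [AddCommGroup G] {p : ℕ} (hp : p.Prime) {P : G}
    (hP : ∃ n, p ^ n • P = 0) (hpP : p • P ≠ 0) {k : ℕ} (hk : 1 ≤ k) (hkp : k ≤ p) :
    k • P ≠ 0 := by
  obtain ⟨n, hn⟩ := hP
  intro h
  rcases hkp.eq_or_lt with rfl | hlt
  · exact hpP h
  · have hco : Nat.Coprime k (p ^ n) :=
      (Nat.coprime_of_lt_prime (by lia) hlt hp).symm.pow_right n
    have h1 : addOrderOf P ∣ 1 := hco ▸ Nat.dvd_gcd (addOrderOf_dvd_of_nsmul_eq_zero h)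
      (addOrderOf_dvd_of_nsmul_eq_zero hn)
    have := addOrderOf_dvd_iff_nsmul_eq_zero.mp h1
    rw [one_nsmul] at this
    exact hpP (by rw [this, smul_zero])

/-- The valuation, normalized by `v p = 1`, of the formal group parameter of a point in the kernel of
reduction. -/
noncomputable def pointVal (p : ℕ) (N : AbsoluteValue F ℝ) {W : WeierstrassCurve F}
    (P : W.toAffine.Point) : ℝ :=
  Real.log (N (xCoord P)) / (-2 * Real.log (N p))

namespace IsSupersingularFor

variable {p : ℕ} {W : WeierstrassCurve F} {N : AbsoluteValue F ℝ} (H : W.IsSupersingularFor p N)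
include H

lemma log_norm_p_neg : Real.log (N p) < 0 := Real.log_neg H.norm_pos H.norm_lt

lemma not_even : ¬ Even (p : ℤ) := by
  rw [Int.even_coe_nat]
  exact fun h ↦ H.ne_two (H.prime.even_iff.mp h)

/-- If |x(P)| ≤ 1, then |ψ_p(x(P))| = 1, so pP ≠ 0 and |x(pP)| = |Φ_p(x(P))| ≤ 1. This contradicts
the induction hypothesis for pP. -/
lemma one_lt_norm_xCoord {P : W.toAffine.Point} (hP : ∃ n, p ^ n • P = 0) (h0 : P ≠ 0) :
    1 < N (xCoord P) := by
  obtain ⟨n, hn⟩ := hP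
  induction n generalizing P with
  | zero => exact absurd (by simpa using hn) h0
  | succ n ih =>
    by_contra! hx
    have h1 : N ((W.preΨ p).eval (xCoord P)) = 1 :=
      AbsoluteValue.eval_eq_one_of_coeff H.nonarch H.coeff_zero H.coeff_lt hx
    have hpP : p • P ≠ 0 := by
      intro h
      rw [(eval_preΨ_xCoord_eq_zero_iff H.prime H.ne_two h0).mpr h] at h1
      simp at h1
    have h2 := ih hpP (by rw [← mul_smul, ← pow_succ, hn])
    have e := congrArg N (xCoord_nsmul H.prime.one_le fun k hk hkp ↦
      nsmul_ne_zero_of_primary H.prime ⟨_, hn⟩ hpP hk hkp)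
    rw [map_mul, eval_ΨSq_odd H.not_even, map_pow, h1, one_pow, mul_one] at e
    exact h2.not_ge (e ▸ AbsoluteValue.eval_le_one_of_nonarchimedean H.nonarch
      (H.norm_coeff_Φ p) hx)

variable {s : Finset W.toAffine.Point} (hs : ∀ T, T ∈ s ↔ T ≠ 0 ∧ p • T = 0)
  (hψ : W.preΨ p = C (p : F) * ∏ r ∈ s.image xCoord, (X - C r))
  (h2 : ∀ r ∈ s.image xCoord, (s.filter fun P ↦ xCoord P = r).card = 2)

include hs

lemma one_lt_norm_of_mem {T : W.toAffine.Point} (hT : T ∈ s) : 1 < N (xCoord T) :=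
  H.one_lt_norm_xCoord ⟨1, by rw [pow_one, ((hs T).mp hT).2]⟩ ((hs T).mp hT).1

omit hs
include hψ h2

-- Each root of ψ_p is shared by two torsion points, whence the squares.
omit H in
lemma norm_sq_mul_prod (x : F) :
    N p ^ 2 * ∏ T ∈ s, N (x - xCoord T) = N ((W.preΨ p).eval x) ^ 2 := by
  rw [hψ, Finset.prod_comp (fun r ↦ N (x - r)) xCoord, eval_mul, eval_C, eval_prod, map_mul,
    mul_pow, map_prod, ← Finset.prod_pow]
  congr 1
  refine Finset.prod_congr rfl fun r hr ↦ ?_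
  rw [h2 r hr, eval_sub, eval_X, eval_C]

lemma norm_sq_mul_prod_norm : N p ^ 2 * ∏ T ∈ s, N (xCoord T) = 1 := by
  have h := norm_sq_mul_prod (N := N) hψ h2 0
  rw [← coeff_zero_eq_eval_zero, H.coeff_zero, one_pow] at h
  rw [← h]
  congr 1
  refine Finset.prod_congr rfl fun T _ ↦ ?_
  rw [zero_sub, N.map_neg]

-- Multiplicative form of the sum rule for [p]. It compares |Φ_p(x)| = |x|^(p^2) and |ψ_p(x)|^2 =
-- |p|^2 ∏|x - x(T)| with the product over T of the identity for |x(P+T)||x(P-T)|; the symmetry T ↦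
-- -T makes the latter a perfect square.
include hs

lemma norm_xCoord_smul (hcard : s.card = p ^ 2 - 1) {P : W.toAffine.Point}
    (hP : ∃ n, p ^ n • P = 0) (hpP : p • P ≠ 0) :
    N (xCoord (p • P)) = N (xCoord P) * ∏ T ∈ s, N (xCoord (P + T)) := by
  have hP0 : P ≠ 0 := fun h ↦ hpP (by rw [h, smul_zero])
  have hx := H.one_lt_norm_xCoord hP hP0
  have hx0 := one_pos.trans hx
  have hne : ∀ T ∈ s, xCoord P ≠ xCoord T := by
    intro T hT h
    obtain ⟨hT0, hpT⟩ := (hs T).mp hT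
    rcases (xCoord_eq_iff hP0 hT0).mp h with rfl | rfl
    · exact hpP hpT
    · exact hpP (by rw [smul_neg, hpT, neg_zero])
  set A := ∏ T ∈ s, N (xCoord (P + T)) with hA
  set B := ∏ T ∈ s, N (xCoord P - xCoord T) with hB
  set D := ∏ T ∈ s, N (xCoord T) with hD
  have hA' : A = ∏ T ∈ s, N (xCoord (P - T)) := by
    refine Finset.prod_nbij' (fun T ↦ -T) (fun T ↦ -T) ?_ ?_ ?_ ?_ ?_
    · intro T hT
      simpa [hs] using hT
    · intro T hT
      simpa [hs] using hT
    · simp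
    · simp
    · simp
  have hB0 : 0 < B := Finset.prod_pos fun T hT ↦ N.pos (sub_ne_zero.mpr (hne T hT))
  have hAB : A * B = N (xCoord P) ^ (p ^ 2 - 1) * D := by
    have hsq : (A * B) ^ 2 = (N (xCoord P) ^ (p ^ 2 - 1) * D) ^ 2 := by
      calc (A * B) ^ 2 = A * A * B ^ 2 := by ring
        _ = ∏ T ∈ s, N (xCoord (P + T)) * N (xCoord (P - T)) *
            N (xCoord P - xCoord T) ^ 2 := by
          nth_rw 2 [hA']
          rw [hA, hB, Finset.prod_mul_distrib, Finset.prod_mul_distrib, Finset.prod_pow]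
        _ = ∏ T ∈ s, (N (xCoord P) * N (xCoord T)) ^ 2 :=
          Finset.prod_congr rfl fun T hT ↦ H.norm_add_mul_norm_sub hx (H.one_lt_norm_of_mem hs hT)
            hP0 ((hs T).mp hT).1 (hne T hT)
        _ = _ := by
          rw [Finset.prod_pow, Finset.prod_mul_distrib, Finset.prod_const, hcard]
    refine (pow_left_inj₀ ?_ ?_ two_ne_zero).mp hsq
    · exact mul_nonneg (Finset.prod_nonneg fun _ _ ↦ N.nonneg _) hB0.le
    · exact mul_nonneg (by positivity) (Finset.prod_nonneg fun _ _ ↦ N.nonneg _)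
  have hpD : N p ^ 2 * D = 1 := H.norm_sq_mul_prod_norm hψ h2
  have e := congrArg N (xCoord_nsmul H.prime.one_le fun k hk hkp ↦
    nsmul_ne_zero_of_primary H.prime hP hpP hk hkp)
  rw [map_mul, eval_ΨSq_odd H.not_even, map_pow, ← norm_sq_mul_prod hψ h2,
    AbsoluteValue.eval_eq_pow_of_monic H.nonarch (H.norm_coeff_Φ p) (W.leadingCoeff_Φ p) hx,
    natDegree_Φ, Int.natAbs_natCast, ← Nat.sub_add_cancel (Nat.one_le_pow 2 p H.prime.pos),
    pow_succ (N (xCoord P))] at e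
  have hpB : 0 < N p ^ 2 * B := mul_pos (pow_pos H.norm_pos 2) hB0
  refine mul_right_cancel₀ hpB.ne' (e.trans ?_)
  linear_combination (-N p ^ 2 * N (xCoord P)) * hAB - N (xCoord P) * N (xCoord P) ^ (p ^ 2 - 1) * hpD

lemma sum_pointVal : ∑ T ∈ s, pointVal p N T = 1 := by
  have hlog := H.log_norm_p_neg
  simp only [pointVal]
  rw [← Finset.sum_div, ← Real.log_prod fun T hT ↦
    (one_pos.trans (H.one_lt_norm_of_mem hs hT)).ne', div_eq_one_iff_eq (by linarith)]
  have h := H.norm_sq_mul_prod_norm hψ h2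
  have hD : ∏ T ∈ s, N (xCoord T) ≠ 0 := fun h0 ↦ by simp [h0] at h
  have := congrArg Real.log h
  rw [Real.log_mul (pow_ne_zero 2 H.norm_pos.ne') hD, Real.log_pow, Real.log_one] at this
  push_cast at this
  linarith

/-- The valuation on the `p`-primary torsion. -/
noncomputable def torsionNorm (hcard : s.card = p ^ 2 - 1) : TorsionNorm p W.toAffine.Point where
  S := s
  h := pointVal p N
  prime := H.prime
  mem_S := hs
  card_S := hcard
  h_pos T hT := div_pos (Real.log_pos (H.one_lt_norm_of_mem hs hT))
    (by linarith [H.log_norm_p_neg])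
  h_neg P := by rw [pointVal, xCoord_neg, pointVal]
  h_add P Q hP hQ hP0 hQ0 h0 := by
    have hP1 := H.one_lt_norm_xCoord hP hP0
    have hQ1 := H.one_lt_norm_xCoord hQ hQ0
    have hlog : 0 < -2 * Real.log (N p) := by linarith [H.log_norm_p_neg]
    rcases min_le_iff.mp (H.norm_add_ge hP1 hQ1 hP0 hQ0 h0) with h | h
    · refine min_le_iff.mpr (Or.inl ?_)
      exact div_le_div_of_nonneg_right (Real.log_le_log (by linarith) h) hlog.le
    · refine min_le_iff.mpr (Or.inr ?_)
      exact div_le_div_of_nonneg_right (Real.log_le_log (by linarith) h) hlog.le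
  sum_S := H.sum_pointVal hs hψ h2
  h_smul P hP hpP := by
    have hP0 : P ≠ 0 := fun h ↦ hpP (by rw [h, smul_zero])
    have hprim : ∀ T ∈ s, xCoord (P + T) ≠ 0 := by
      intro T hT h
      have hpT := ((hs T).mp hT).2
      have hPT : P + T ≠ 0 := fun h ↦ hpP (by
        rw [eq_neg_of_add_eq_zero_left h, smul_neg, hpT, neg_zero])
      obtain ⟨n, hn⟩ := hP
      have := H.one_lt_norm_xCoord (P := P + T) ⟨n + 1, by
        rw [pow_succ', mul_smul, smul_add, hn, zero_add, ← mul_smul, ← pow_succ', pow_succ,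
          mul_smul, hpT, smul_zero]⟩ hPT
      rw [h, map_zero] at this
      linarith
    simp only [pointVal]
    rw [H.norm_xCoord_smul hs hψ h2 hcard hP hpP, Real.log_mul
      (one_pos.trans (H.one_lt_norm_xCoord hP hP0)).ne'
      (Finset.prod_ne_zero_iff.mpr fun T hT ↦ N.ne_zero (hprim T hT)),
      Real.log_prod fun T hT ↦ N.ne_zero (hprim T hT), add_div, Finset.sum_div]

end IsSupersingularFor
end WeierstrassCurve
end SupersingularTorsion

/-! ### Reading μ off the roots of the division polynomial. -/

section DivisionPolynomialCoefficient

open Polynomial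

lemma coeff_C_mul_prod_X_sub_C {F : Type*} [Field F] (c : F) (I : Finset F) {k m : ℕ}
    (hk : k + m = I.card) :
    (C c * ∏ r ∈ I, (X - C r)).coeff k = c * ∑ t ∈ I.powersetCard m, ∏ r ∈ t, -r := by
  have h : ∏ r ∈ I, (X - C r) = ∏ r ∈ I, (X + C (-r)) := by
    simp only [map_neg, sub_eq_add_neg]
  rw [coeff_C_mul, h, Finset.prod_X_add_C_coeff _ _ (by lia), ← hk, Nat.add_sub_cancel_left]

namespace AbsoluteValue

variable {F : Type*} [Field F] {N : AbsoluteValue F ℝ}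

lemma norm_coeff_le_of_roots (hN : IsNonarchimedean N) (c : F) (I : Finset F) {k m : ℕ}
    (hk : k + m = I.card) {A : ℝ} (hA : 0 ≤ A) (hI : ∀ r ∈ I, N r ≤ A) :
    N ((C c * ∏ r ∈ I, (X - C r)).coeff k) ≤ N c * A ^ m := by
  rw [coeff_C_mul_prod_X_sub_C c I hk, map_mul]
  gcongr
  refine N.sum_le_of_nonarchimedean hN (by positivity) fun t ht ↦ ?_
  obtain ⟨htI, rfl⟩ := Finset.mem_powersetCard.mp ht
  rw [map_prod]
  exact (Finset.prod_le_prod (fun _ _ ↦ N.nonneg _) fun r hr ↦ by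
    rw [N.map_neg]; exact hI r (htI hr)).trans_eq (Finset.prod_const A)

/-- In the elementary symmetric function of degree |J|, the monomial of J is strictly largest: any
other subset of that size omits a root in J and so contains a smaller one. -/
lemma norm_coeff_eq_of_roots (hN : IsNonarchimedean N) (c : F) {I J : Finset F} (hJ : J ⊆ I) {k : ℕ}
    (hk : k + J.card = I.card) {A : ℝ} (hJA : ∀ r ∈ J, N r = A)
    (hI : ∀ r ∈ I, r ∉ J → N r < A) (hI0 : ∀ r ∈ I, 0 < N r) :
    N ((C c * ∏ r ∈ I, (X - C r)).coeff k) = N c * A ^ J.card := by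
  have hprod : N (∏ r ∈ J, -r) = A ^ J.card := by
    rw [map_prod]
    exact Finset.prod_eq_pow_card fun r hr ↦ by rw [N.map_neg, hJA r hr]
  rw [coeff_C_mul_prod_X_sub_C c I hk, map_mul, ← hprod]
  congr 1
  refine hN.apply_sum_eq_of_lt (fun a ↦ (N.map_neg a).symm)
    (Finset.mem_powersetCard.mpr ⟨hJ, rfl⟩) fun t ht htJ ↦ ?_
  obtain ⟨htI, hcard⟩ := Finset.mem_powersetCard.mp ht
  obtain ⟨r, hrt, hrJ⟩ : ∃ r ∈ t, r ∉ J := by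
    by_contra! h
    exact htJ (Finset.eq_of_subset_of_card_le h hcard.ge)
  rw [hprod, map_prod, ← hcard, ← Finset.prod_const]
  refine Finset.prod_lt_prod (fun i hi ↦ ?_) (fun i hi ↦ ?_) ⟨r, hrt, ?_⟩
  · rw [N.map_neg]
    exact hI0 i (htI hi)
  · rw [N.map_neg]
    by_cases h : i ∈ J
    · exact (hJA i h).le
    · exact (hI i (htI hi) h).le
  · rw [N.map_neg]
    exact hI r (htI hrt) hrJ

end AbsoluteValue

namespace WeierstrassCurve

open WeierstrassCurve.Affine

variable {F : Type*} [Field F]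

lemma two_mul_card_image_xCoord {W : WeierstrassCurve F} {s : Finset W.toAffine.Point}
    (h2 : ∀ r ∈ s.image xCoord, (s.filter fun P ↦ xCoord P = r).card = 2) :
    (s.image xCoord).card * 2 = s.card := by
  rw [Finset.card_eq_sum_card_image xCoord s, Finset.sum_congr rfl h2, Finset.sum_const, smul_eq_mul]

namespace IsSupersingularFor

variable {p : ℕ} {W : WeierstrassCurve F} {N : AbsoluteValue F ℝ} (H : W.IsSupersingularFor p N)
include H

variable {s : Finset W.toAffine.Point} (hs : ∀ T, T ∈ s ↔ T ≠ 0 ∧ p • T = 0)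
  (hψ : W.preΨ p = C (p : F) * ∏ r ∈ s.image xCoord, (X - C r))
  (h2 : ∀ r ∈ s.image xCoord, (s.filter fun P ↦ xCoord P = r).card = 2)

include hs in
lemma norm_xCoord_eq_exp {T : W.toAffine.Point} (hT : T ∈ s) :
    N (xCoord T) = Real.exp (pointVal p N T * (-2 * Real.log (N p))) := by
  rw [pointVal, div_mul_cancel₀ _ (by linarith [H.log_norm_p_neg]),
    Real.exp_log (one_pos.trans (H.one_lt_norm_of_mem hs hT))]

lemma exists_eq_two_mul_add_one : ∃ m, p = 2 * m + 1 := H.prime.odd_of_ne_two H.ne_two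

-- The coefficient has codegree m = (p-1)/2. A product of m roots, each of valuation -2/(p^2-1),
-- times p has valuation 1 - 1/(p+1) = p/(p+1).
include hs hψ h2

lemma le_val_coeff_of_constant (hcard : s.card = p ^ 2 - 1)
    (hc : ∀ T ∈ s, pointVal p N T = 1 / ((p : ℝ) ^ 2 - 1))
    (h0 : (W.preΨ p).coeff ((p ^ 2 - p) / 2) ≠ 0) :
    (p : ℝ) / (p + 1) ≤ Real.log (N ((W.preΨ p).coeff ((p ^ 2 - p) / 2))) / Real.log (N p) := by
  obtain ⟨m, hm⟩ := H.exists_eq_two_mul_add_one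
  have hlog := H.log_norm_p_neg
  have hI := two_mul_card_image_xCoord h2
  have hk : (p ^ 2 - p) / 2 + m = (s.image xCoord).card := by
    rw [hcard] at hI
    have h1 : p ^ 2 - 1 = 2 * (2 * m * m + 2 * m) := by
      rw [hm]; exact Nat.sub_eq_of_eq_add (by ring)
    have h2 : p ^ 2 - p = 2 * (2 * m * m + m) := by
      rw [hm]; exact Nat.sub_eq_of_eq_add (by ring)
    lia
  set A := Real.exp (1 / ((p : ℝ) ^ 2 - 1) * (-2 * Real.log (N p))) with hA
  have hle := N.norm_coeff_le_of_roots H.nonarch p _ hk (Real.exp_pos _).le (A := A) (by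
    intro r hr
    obtain ⟨T, hT, rfl⟩ := Finset.mem_image.mp hr
    rw [H.norm_xCoord_eq_exp hs hT, hc T hT])
  rw [← hψ] at hle
  have hlogle := Real.log_le_log (N.pos h0) hle
  rw [Real.log_mul H.norm_pos.ne' (pow_ne_zero _ (Real.exp_pos _).ne'), Real.log_pow,
    Real.log_exp] at hlogle
  rw [le_div_iff_of_neg hlog]
  refine hlogle.trans (le_of_eq ?_)
  have hp1 : (1 : ℝ) < p := by exact_mod_cast H.prime.one_lt
  have hpm : (p : ℝ) = 2 * m + 1 := by exact_mod_cast hm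
  have hm0 : (m : ℝ) ≠ 0 := by intro h; rw [h] at hpm; linarith
  have hm1 : (m : ℝ) + 1 ≠ 0 := by positivity
  rw [show (p : ℝ) ^ 2 - 1 = 4 * m * (m + 1) by rw [hpm]; ring,
    show (p : ℝ) + 1 = 2 * (m + 1) by rw [hpm]; ring, hpm]
  field_simp
  ring

lemma val_coeff_of_hasBreak (hcard : s.card = p ^ 2 - 1) {K : AddSubgroup W.toAffine.Point}
    {α β : ℝ} (hB : (H.torsionNorm hs hψ h2 hcard).HasBreak K α β) :
    (W.preΨ p).coeff ((p ^ 2 - p) / 2) ≠ 0 ∧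
    Real.log (N ((W.preΨ p).coeff ((p ^ 2 - p) / 2))) / Real.log (N p) = 1 - ((p : ℝ) - 1) * α := by
  obtain ⟨m, hm⟩ := H.exists_eq_two_mul_add_one
  have hlog := H.log_norm_p_neg
  have hI := two_mul_card_image_xCoord h2
  set sK := s.filter (· ∈ K) with hsK
  -- K is stable under negation, so its p-1 nonzero points give exactly (p-1)/2 roots. These are the
  -- roots of largest absolute value, and they form the dominant monomial.
  have hfib : ∀ r ∈ sK.image xCoord, (sK.filter fun P ↦ xCoord P = r).card = 2 := by
    intro r hr
    obtain ⟨T, hT, rfl⟩ := Finset.mem_image.mp hr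
    rw [Finset.mem_filter] at hT
    rw [← h2 _ (Finset.mem_image_of_mem xCoord hT.1)]
    congr 1
    ext P
    simp only [hsK, Finset.mem_filter]
    refine ⟨fun h ↦ ⟨h.1.1, h.2⟩, fun h ↦ ⟨⟨h.1, ?_⟩, h.2⟩⟩
    rcases (xCoord_eq_iff ((hs P).mp h.1).1 ((hs T).mp hT.1).1).mp h.2 with rfl | rfl
    · exact hT.2
    · exact K.neg_mem hT.2
  have hJ := two_mul_card_image_xCoord hfib
  have hsKcard : sK.card = p - 1 := hB.card_mem
  have hJm : (sK.image xCoord).card = m := by lia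
  have hk : (p ^ 2 - p) / 2 + (sK.image xCoord).card = (s.image xCoord).card := by
    rw [hcard] at hI
    have h1 : p ^ 2 - 1 = 2 * (2 * m * m + 2 * m) := by
      rw [hm]; exact Nat.sub_eq_of_eq_add (by ring)
    have h2 : p ^ 2 - p = 2 * (2 * m * m + m) := by
      rw [hm]; exact Nat.sub_eq_of_eq_add (by ring)
    lia
  set A := Real.exp (α * (-2 * Real.log (N p))) with hA
  have he := N.norm_coeff_eq_of_roots H.nonarch p
    (Finset.image_subset_image (Finset.filter_subset _ s)) hk (A := A) (by
      intro r hr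
      obtain ⟨T, hT, rfl⟩ := Finset.mem_image.mp hr
      rw [Finset.mem_filter] at hT
      rw [H.norm_xCoord_eq_exp hs hT.1, hA]
      congr 2
      exact hB.h_mem T hT.1 hT.2) (by
      intro r hr hrJ
      obtain ⟨T, hT, rfl⟩ := Finset.mem_image.mp hr
      have hTK : T ∉ K := fun h ↦
        hrJ (Finset.mem_image_of_mem xCoord (Finset.mem_filter.mpr ⟨hT, h⟩))
      have hβ : pointVal p N T = β := hB.h_not_mem T hT hTK
      rw [H.norm_xCoord_eq_exp hs hT, hA, Real.exp_lt_exp, hβ]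
      exact mul_lt_mul_of_pos_right hB.lt (by linarith)) (by
      intro r hr
      obtain ⟨T, hT, rfl⟩ := Finset.mem_image.mp hr
      exact one_pos.trans (H.one_lt_norm_of_mem hs hT))
  rw [← hψ, hJm] at he
  refine ⟨fun h ↦ ?_, ?_⟩
  · rw [h, map_zero] at he
    exact (mul_pos H.norm_pos (pow_pos (Real.exp_pos _) m)).ne he
  · rw [he, Real.log_mul H.norm_pos.ne' (pow_ne_zero _ (Real.exp_pos _).ne'), Real.log_pow,
      Real.log_exp, div_eq_iff hlog.ne]
    have hpm : (p : ℝ) = 2 * m + 1 := by exact_mod_cast hm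
    rw [hpm]
    ring

end IsSupersingularFor
end WeierstrassCurve
end DivisionPolynomialCoefficient

/-! ### The local absolute value, and translation of the arithmetic definitions. -/

section LocalAbsoluteValue

/-- The spectral norm of an algebraic extension of a complete nonarchimedean field. -/
noncomputable def spectralAbsoluteValue (K L : Type*) [NontriviallyNormedField K]
    [IsUltrametricDist K] [CompleteSpace K] [Field L] [Algebra K L] [Algebra.IsAlgebraic K L] :
    AbsoluteValue L ℝ where
  toFun := spectralNorm K L
  map_mul' := spectralAlgNorm_mul
  nonneg' := spectralNorm_nonneg
  eq_zero' x := ⟨fun h ↦ eq_zero_of_map_spectralNorm_eq_zero h (Algebra.IsAlgebraic.isAlgebraic x),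
    fun h ↦ h ▸ spectralNorm_zero⟩
  add_le' x y := (isNonarchimedean_spectralNorm x y).trans
    (max_le_add_of_nonneg (spectralNorm_nonneg x) (spectralNorm_nonneg y))

namespace FormalTorsion

variable {K : Type*} [Field K] [NumberField K] (p : ℕ) (𝔭 : HeightOneSpectrum (𝓞 K))

lemma exists_one_lt_norm : ∃ x : 𝔭.adicCompletion K, 1 < ‖x‖ := by
  obtain ⟨r, hr, hr0⟩ := Submodule.exists_mem_ne_zero_of_ne_bot 𝔭.ne_bot
  have h1 := (FinitePlace.norm_lt_one_iff_mem K 𝔭 r).mpr hr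
  refine ⟨(FinitePlace.embedding 𝔭 (algebraMap _ K r))⁻¹, ?_⟩
  rw [norm_inv]
  refine (one_lt_inv₀ (norm_pos_iff.mpr ?_)).mpr h1
  rw [map_ne_zero]
  exact (map_ne_zero_iff _ (RingOfIntegers.coe_injective)).mpr hr0

/-- The extension of the `𝔭`-adic absolute value to the algebraic closure of `K_𝔭`. -/
noncomputable def localAbs : AbsoluteValue (LocalClosure 𝔭) ℝ :=
  letI : NontriviallyNormedField (𝔭.adicCompletion K) :=
    { HeightOneSpectrum.instNormedFieldValuedAdicCompletion K 𝔭 with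
      non_trivial := exists_one_lt_norm 𝔭 }
  spectralAbsoluteValue (𝔭.adicCompletion K) (LocalClosure 𝔭)

lemma isNonarchimedean_localAbs : IsNonarchimedean (localAbs 𝔭) :=
  letI : NontriviallyNormedField (𝔭.adicCompletion K) :=
    { HeightOneSpectrum.instNormedFieldValuedAdicCompletion K 𝔭 with
      non_trivial := exists_one_lt_norm 𝔭 }
  isNonarchimedean_spectralNorm

lemma localAbs_algebraMap (x : 𝔭.adicCompletion K) :
    localAbs 𝔭 (algebraMap _ _ x) = ‖x‖ :=
  letI : NontriviallyNormedField (𝔭.adicCompletion K) :=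
    { HeightOneSpectrum.instNormedFieldValuedAdicCompletion K 𝔭 with
      non_trivial := exists_one_lt_norm 𝔭 }
  spectralNorm_extends x

instance charZero_localClosure : CharZero (LocalClosure 𝔭) :=
  charZero_of_injective_algebraMap (algebraMap K (LocalClosure 𝔭)).injective

lemma val_of_ne_zero {x : LocalClosure 𝔭} (hx : x ≠ 0) :
    val p 𝔭 x = ((Real.log (localAbs 𝔭 x) / Real.log (localAbs 𝔭 p) : ℝ) : WithTop ℝ) :=
  if_neg hx

lemma norm_integer_le (r : 𝔭.adicCompletionIntegers K) : ‖(r : 𝔭.adicCompletion K)‖ ≤ 1 :=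
  Valued.toNormedField.norm_le_one_iff.mpr r.2

lemma norm_integer_lt_iff (r : 𝔭.adicCompletionIntegers K) :
    ‖(r : 𝔭.adicCompletion K)‖ < 1 ↔ r ∈ IsLocalRing.maximalIdeal (𝔭.adicCompletionIntegers K) := by
  rw [Valued.toNormedField.norm_lt_one_iff]
  unfold HeightOneSpectrum.adicCompletionIntegers
  exact (Valuation.mem_maximalIdeal_iff ..).symm

variable {p}
lemma localAbs_natCast_lt (h𝔭 : (p : 𝓞 K) ∈ 𝔭.asIdeal) : localAbs 𝔭 p < 1 := by
  have h := (FinitePlace.norm_lt_one_iff_mem K 𝔭 p).mpr h𝔭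
  rw [← localAbs_algebraMap] at h
  simpa using h

open Polynomial in
/-- The `p`-th division polynomial of a supersingular curve is a nonzero constant. -/
lemma IsSupersingular.degree_preΨ {k : Type*} [Field k] (hp : p.Prime) (hp2 : p ≠ 2)
    {W : WeierstrassCurve k} (hW : IsSupersingular p W) : (W.preΨ p).degree = 0 := by
  obtain ⟨hell, htors⟩ := hW
  have hmap : (W.baseChange (AlgebraicClosure k)).preΨ p =
      (W.preΨ p).map (algebraMap k (AlgebraicClosure k)) := W.map_preΨ _ _
  rw [← Polynomial.degree_map (W.preΨ p) (algebraMap k (AlgebraicClosure k)), ← hmap]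
  by_contra h
  obtain ⟨x, hx⟩ := IsAlgClosed.exists_root _ h
  have : (W.baseChange (AlgebraicClosure k)).IsElliptic :=
    inferInstanceAs (W.map (algebraMap k (AlgebraicClosure k))).IsElliptic
  obtain ⟨P, hP0, -, hP⟩ := WeierstrassCurve.preΨ_root hp hp2 hx
  exact hP0 (htors P hP)

lemma HasGoodSupersingularReduction.isSupersingularFor (hp : p.Prime) (hp2 : p ≠ 2)
    (h𝔭 : (p : 𝓞 K) ∈ 𝔭.asIdeal) {E : WeierstrassCurve K}
    (hE : HasGoodSupersingularReduction p 𝔭 E) :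
    (E.baseChange (LocalClosure 𝔭)).IsSupersingularFor p (localAbs 𝔭) := by
  obtain ⟨hgood, hss⟩ := hE
  set W := E.baseChange (𝔭.adicCompletion K) with hW
  set W₀ := W.integralModel (𝔭.adicCompletionIntegers K) with hW₀
  set f : 𝔭.adicCompletionIntegers K →+* LocalClosure 𝔭 :=
    (algebraMap (𝔭.adicCompletion K) (LocalClosure 𝔭)).comp
      (algebraMap (𝔭.adicCompletionIntegers K) (𝔭.adicCompletion K)) with hf
  have hmap : W₀.map f = E.baseChange (LocalClosure 𝔭) := by
    have h1 : W₀.map (algebraMap _ (𝔭.adicCompletion K)) = W :=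
      W.baseChange_integralModel_eq (𝔭.adicCompletionIntegers K)
    rw [hf, ← WeierstrassCurve.map_map, h1, hW, WeierstrassCurve.baseChange,
      WeierstrassCurve.map_map, ← IsScalarTower.algebraMap_eq]
    rfl
  have hnorm : ∀ r, localAbs 𝔭 (f r) = ‖(r : 𝔭.adicCompletion K)‖ := fun r ↦
    localAbs_algebraMap 𝔭 _
  have hψ : (E.baseChange (LocalClosure 𝔭)).preΨ p = (W₀.preΨ p).map f := by
    rw [← hmap, WeierstrassCurve.map_preΨ]
  have hdeg := hss.degree_preΨ hp hp2
  rw [WeierstrassCurve.reduction, WeierstrassCurve.map_preΨ] at hdeg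
  -- The coefficients come from the integral model, so absolute value below 1 means vanishing in the
  -- residue field, where ψ_p is a nonzero constant.
  have hcoeff : ∀ i, localAbs 𝔭 (((E.baseChange (LocalClosure 𝔭)).preΨ p).coeff i) < 1 ↔
      ((W₀.preΨ p).map (IsLocalRing.residue (𝔭.adicCompletionIntegers K))).coeff i = 0 := by
    intro i
    rw [hψ, Polynomial.coeff_map, Polynomial.coeff_map, hnorm, norm_integer_lt_iff,
      IsLocalRing.residue_eq_zero_iff]
  refine ⟨hp, hp2, isNonarchimedean_localAbs 𝔭, ⟨f.range, W₀.map f.rangeRestrict, ?_, ?_⟩, ?_,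
    localAbs_natCast_lt 𝔭 h𝔭, ?_, ?_⟩
  · rw [WeierstrassCurve.map_map, ← hmap]
    rfl
  · rintro ⟨_, r, rfl⟩
    exact (hnorm r).trans_le (norm_integer_le 𝔭 r)
  · exact (localAbs 𝔭).pos (Nat.cast_ne_zero.mpr hp.ne_zero)
  · refine le_antisymm ?_ (not_lt.mp fun h ↦ ?_)
    · rw [hψ, Polynomial.coeff_map, hnorm]
      exact norm_integer_le 𝔭 _
    · rw [hcoeff] at h
      exact Polynomial.coeff_ne_zero_of_eq_degree hdeg h
  · intro i hi
    rw [hcoeff]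
    exact Polynomial.coeff_eq_zero_of_degree_lt (by rw [hdeg]; exact_mod_cast hi)

open WeierstrassCurve in
lemma mem_kernelOfReduction (h𝔭 : (p : 𝓞 K) ∈ 𝔭.asIdeal) (hp : p.Prime) {E : WeierstrassCurve K}
    {P : GeomPoint 𝔭 E} (hP : 1 < localAbs 𝔭 (xCoord P)) : P ∈ kernelOfReduction p 𝔭 E := by
  rcases P with _ | ⟨x, y, h⟩
  · exact trivial
  · change val p 𝔭 x < 0
    change 1 < localAbs 𝔭 x at hP
    have hp0 : 0 < localAbs 𝔭 p := (localAbs 𝔭).pos (Nat.cast_ne_zero.mpr hp.ne_zero)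
    have hx : x ≠ 0 := fun h ↦ by rw [h, map_zero] at hP; linarith
    rw [val_of_ne_zero p 𝔭 hx, ← WithTop.coe_zero, WithTop.coe_lt_coe]
    exact div_neg_of_pos_of_neg (Real.log_pos hP) (Real.log_neg hp0 (localAbs_natCast_lt 𝔭 h𝔭))

open WeierstrassCurve in
lemma formalVal_eq_pointVal {E : WeierstrassCurve K}
    (H : (E.baseChange (LocalClosure 𝔭)).IsSupersingularFor p (localAbs 𝔭))
    {P : GeomPoint 𝔭 E} (hP : 1 < localAbs 𝔭 (xCoord P)) :
    formalVal p 𝔭 E P = (pointVal p (localAbs 𝔭) P : WithTop ℝ) := by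
  rcases P with _ | ⟨x, y, h⟩
  · change 1 < localAbs 𝔭 0 at hP
    rw [map_zero] at hP
    linarith
  · change 1 < localAbs 𝔭 x at hP
    have hlog := H.log_norm_p_neg
    have hx : x ≠ 0 := fun h ↦ by rw [h, map_zero] at hP; linarith
    have hy2 := H.norm_y_sq h.1 hP
    have hx0 : 0 < localAbs 𝔭 x := (localAbs 𝔭).pos hx
    have hy : y ≠ 0 := by
      rintro rfl
      rw [map_zero] at hy2
      exact (pow_pos hx0 3).ne (by simpa using hy2)
    have hy0 : 0 < localAbs 𝔭 y := (localAbs 𝔭).pos hy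
    change val p 𝔭 (-x / y) = _
    rw [val_of_ne_zero p 𝔭 (div_ne_zero (neg_ne_zero.mpr hx) hy), WithTop.coe_inj, map_div₀,
      (localAbs 𝔭).map_neg, Real.log_div hx0.ne' hy0.ne', pointVal]
    change _ = Real.log (localAbs 𝔭 x) / _
    have := congrArg Real.log hy2
    rw [Real.log_pow, Real.log_pow] at this
    push_cast at this
    rw [div_eq_div_iff hlog.ne (by linarith)]
    linear_combination Real.log (localAbs 𝔭 p) * this

lemma formalVal_zero {E : WeierstrassCurve K} : formalVal p 𝔭 E 0 = ⊤ := if_pos rfl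

lemma mu_eq_val {E : WeierstrassCurve K} : mu p 𝔭 E =
    val p 𝔭 (((E.baseChange (LocalClosure 𝔭)).preΨ p).coeff ((p ^ 2 - p) / 2)) := by
  have hmap : (E.baseChange (LocalClosure 𝔭)).preΨ p =
      (E.preΨ p).map (algebraMap K (LocalClosure 𝔭)) := E.map_preΨ _ _
  rw [hmap, Polynomial.coeff_map, mu]

-- Points of order p lie in the kernel of reduction automatically, so only the comparison of
-- valuations remains in the definition.
open WeierstrassCurve in
lemma isCanonicalSubgroup_iff (h𝔭 : (p : 𝓞 K) ∈ 𝔭.asIdeal) {E : WeierstrassCurve K}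
    (H : (E.baseChange (LocalClosure 𝔭)).IsSupersingularFor p (localAbs 𝔭))
    {s : Finset (GeomPoint 𝔭 E)} (hs : ∀ T, T ∈ s ↔ T ≠ 0 ∧ p • T = 0)
    (C : AddSubgroup (GeomPoint 𝔭 E)) :
    IsCanonicalSubgroup p 𝔭 E C ↔ ∃ R ∈ s, ∃ Q ∈ s,
      pointVal p (localAbs 𝔭) Q < pointVal p (localAbs 𝔭) R ∧ C = AddSubgroup.zmultiples R := by
  have hord : ∀ T, addOrderOf T = p ↔ T ∈ s := fun T ↦ by
    have : Fact p.Prime := ⟨H.prime⟩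
    rw [hs, addOrderOf_eq_prime_iff, and_comm]
  have hker : ∀ T ∈ s, T ∈ kernelOfReduction p 𝔭 E := fun T hT ↦
    mem_kernelOfReduction 𝔭 h𝔭 H.prime (H.one_lt_norm_of_mem hs hT)
  have hval : ∀ T ∈ s, formalVal p 𝔭 E T = pointVal p (localAbs 𝔭) T := fun T hT ↦
    formalVal_eq_pointVal 𝔭 H (H.one_lt_norm_of_mem hs hT)
  constructor
  · rintro ⟨R, Q, -, hR, -, hQ, hlt, rfl⟩
    rw [hord] at hR hQ
    rw [hval R hR, hval Q hQ, WithTop.coe_lt_coe] at hlt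
    exact ⟨R, hR, Q, hQ, hlt, rfl⟩
  · rintro ⟨R, hR, Q, hQ, hlt, rfl⟩
    refine ⟨R, Q, hker R hR, (hord R).mpr hR, hker Q hQ, (hord Q).mpr hQ, ?_, rfl⟩
    rwa [hval R hR, hval Q hQ, WithTop.coe_lt_coe]

end FormalTorsion
end LocalAbsoluteValue

/-! ### Assembly of the main theorem. -/

section MainTheorem

lemma exists_isLeast_inv_le {p : ℕ} (hp : p.Prime) {μ : ℝ} (hμ : 0 < μ) :
    ∃ s : ℕ, IsLeast {j : ℕ | 1 / ((p : ℝ) ^ j * (p + 1)) ≤ μ} s := by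
  have hp1 : (1 : ℝ) < p := by exact_mod_cast hp.one_lt
  have hex : ∃ j : ℕ, 1 / ((p : ℝ) ^ j * (p + 1)) ≤ μ := by
    obtain ⟨j, hj⟩ := pow_unbounded_of_one_lt (1 / μ) hp1
    refine ⟨j, ?_⟩
    rw [div_le_iff₀ (by positivity)]
    rw [div_lt_iff₀ hμ] at hj
    nlinarith [pow_pos (one_pos.trans hp1) j, mul_pos hμ (pow_pos (one_pos.trans hp1) j)]
  exact ⟨Nat.find hex, Nat.find_spec hex, fun j hj ↦ Nat.find_min' hex hj⟩

lemma one_sub_pow_div_pow_sub {a μ : ℝ} {n s : ℕ} (hs : s + 1 < n) :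
    (1 - a ^ s * μ) / (a ^ s * (a - 1)) / a ^ (2 * (n - 1 - s)) =
      (1 - a ^ s * μ) / (a ^ (2 * n - s - 2) * (a - 1)) := by
  rw [div_div, show 2 * n - s - 2 = s + 2 * (n - 1 - s) by lia, pow_add]
  congr 1
  ring

end MainTheorem

theorem mainTheorem1 {K : Type*} [Field K] [NumberField K]
    (p : ℕ) (hp : p.Prime) (hp2 : p ≠ 2)
    (𝔭 : HeightOneSpectrum (𝓞 K)) (h𝔭 : (p : 𝓞 K) ∈ 𝔭.asIdeal)
    (E : WeierstrassCurve K) [E.IsElliptic]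
    (hE : FormalTorsion.HasGoodSupersingularReduction p 𝔭 E)
    (n : ℕ) (hn : 1 ≤ n)
    (P : FormalTorsion.GeomPoint 𝔭 E) (hP : addOrderOf P = p ^ n) :
    -- the point lies in the formal group
    P ∈ FormalTorsion.kernelOfReduction p 𝔭 E ∧
    -- no canonical subgroup
    ((((p : ℝ) / (p + 1) : ℝ) : WithTop ℝ) ≤ FormalTorsion.mu p 𝔭 E →
      (¬ ∃ C, FormalTorsion.IsCanonicalSubgroup p 𝔭 E C) ∧
      FormalTorsion.formalVal p 𝔭 E P =
        ((1 / ((p : ℝ) ^ (2 * n) - (p : ℝ) ^ (2 * n - 2)) : ℝ) : WithTop ℝ)) ∧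
    -- a canonical subgroup
    (FormalTorsion.mu p 𝔭 E < (((p : ℝ) / (p + 1) : ℝ) : WithTop ℝ) →
      ∃ μ : ℝ, FormalTorsion.mu p 𝔭 E = (μ : WithTop ℝ) ∧ 0 < μ ∧
      ∃ C : AddSubgroup (FormalTorsion.GeomPoint 𝔭 E),
        FormalTorsion.IsCanonicalSubgroup p 𝔭 E C ∧
        (∀ C', FormalTorsion.IsCanonicalSubgroup p 𝔭 E C' → C' = C) ∧
        (p ^ (n - 1) • P ∉ C →
          FormalTorsion.formalVal p 𝔭 E P =
            ((μ / ((p : ℝ) ^ (2 * n - 2) * ((p : ℝ) ^ 2 - p)) : ℝ) : WithTop ℝ)) ∧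
        (p ^ (n - 1) • P ∈ C →
          (n = 1 →
            FormalTorsion.formalVal p 𝔭 E P = (((1 - μ) / ((p : ℝ) - 1) : ℝ) : WithTop ℝ)) ∧
          (1 < n →
            (∀ m : ℕ,
              IsLeast {j : ℕ | FormalTorsion.formalVal p 𝔭 E (p ^ j • P) =
                ((μ / ((p : ℝ) ^ 2 - p) : ℝ) : WithTop ℝ)} m →
              FormalTorsion.formalVal p 𝔭 E P =
                ((μ / ((p : ℝ) ^ (2 * m) * ((p : ℝ) ^ 2 - p)) : ℝ) : WithTop ℝ)) ∧
            ((¬ ∃ m : ℕ, FormalTorsion.formalVal p 𝔭 E (p ^ m • P) =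
                ((μ / ((p : ℝ) ^ 2 - p) : ℝ) : WithTop ℝ)) →
              ∃ s : ℕ, IsLeast {j : ℕ | 1 / ((p : ℝ) ^ j * (p + 1)) ≤ μ} s ∧
                (s + 1 < n →
                  FormalTorsion.formalVal p 𝔭 E P =
                    (((1 - (p : ℝ) ^ s * μ) /
                      ((p : ℝ) ^ (2 * n - s - 2) * ((p : ℝ) - 1)) : ℝ) : WithTop ℝ)) ∧
                (n ≤ s + 1 →
                  FormalTorsion.formalVal p 𝔭 E P =
                    (((1 - (p : ℝ) ^ (n - 1) * μ) /
                      ((p : ℝ) ^ (n - 1) * ((p : ℝ) - 1)) : ℝ) : WithTop ℝ) ∧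
                  {R : FormalTorsion.GeomPoint 𝔭 E |
                    R ∈ FormalTorsion.kernelOfReduction p 𝔭 E ∧ p • R = p • P ∧
                    FormalTorsion.formalVal p 𝔭 E R =
                      (((1 - (p : ℝ) ^ (n - 1) * μ) /
                        ((p : ℝ) ^ (n - 1) * ((p : ℝ) - 1)) : ℝ) : WithTop ℝ)}.ncard = p ∧
                  {R : FormalTorsion.GeomPoint 𝔭 E |
                    R ∈ FormalTorsion.kernelOfReduction p 𝔭 E ∧ p • R = p • P ∧
                    FormalTorsion.formalVal p 𝔭 E R =
                      ((μ / ((p : ℝ) ^ 2 - p) : ℝ) : WithTop ℝ)}.ncard = p ^ 2 - p))))) := by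
  have : (E.baseChange (FormalTorsion.LocalClosure 𝔭)).IsElliptic :=
    inferInstanceAs (E.map (algebraMap K (FormalTorsion.LocalClosure 𝔭))).IsElliptic
  have H := hE.isSupersingularFor 𝔭 hp hp2 h𝔭
  obtain ⟨s, hs, hcard, hψ, h2⟩ :=
    (E.baseChange (FormalTorsion.LocalClosure 𝔭)).exists_torsion_finset hp hp2
  set N := H.torsionNorm hs hψ h2 hcard
  have hp1 : (1 : ℝ) < p := by exact_mod_cast hp.one_lt
  have hp0 : (0 : ℝ) < p := one_pos.trans hp1
  have hpp : (0 : ℝ) < (p : ℝ) ^ 2 - p := by nlinarith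
  -- The abstract results are indexed by the k for which p^k P is a nonzero p-torsion point, one
  -- less than the exponent of the order.
  obtain ⟨k, rfl⟩ : ∃ k, n = k + 1 := ⟨n - 1, by lia⟩
  simp only [Nat.add_sub_cancel]
  have hPn : p ^ (k + 1) • P = 0 := hP ▸ addOrderOf_nsmul_eq_zero P
  have hPk : p ^ k • P ≠ 0 := fun h ↦ by
    have := addOrderOf_le_of_nsmul_eq_zero (pow_pos hp.pos k) h
    rw [hP] at this
    exact this.not_gt (Nat.pow_lt_pow_right hp.one_lt k.lt_succ_self)
  have hPS : p ^ k • P ∈ N.S := (N.mem_S _).mpr ⟨hPk, by rw [← mul_smul, ← pow_succ', hPn]⟩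
  have hP0 : P ≠ 0 := fun h ↦ hPk (by rw [h]; exact nsmul_zero _)
  have hx := H.one_lt_norm_xCoord ⟨_, hPn⟩ hP0
  have hval : ∀ {Q}, 1 < FormalTorsion.localAbs 𝔭 (WeierstrassCurve.xCoord Q) →
      FormalTorsion.formalVal p 𝔭 E Q = (N.h Q : WithTop ℝ) :=
    fun h ↦ FormalTorsion.formalVal_eq_pointVal 𝔭 H h
  have hcan := FormalTorsion.isCanonicalSubgroup_iff 𝔭 h𝔭 H hs
  refine ⟨FormalTorsion.mem_kernelOfReduction 𝔭 h𝔭 hp hx, ?_⟩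
  rw [hval hx, FormalTorsion.mu_eq_val]
  -- The split is on the shape of h, and μ is computed in each case; the range of μ that does not
  -- match is then contradictory.
  rcases N.constant_or_hasBreak with hc | ⟨C, α, β, hB⟩
  · refine ⟨fun _ ↦ ⟨?_, ?_⟩, fun hlt ↦ absurd hlt (not_lt.mpr ?_)⟩
    · rintro ⟨C, hC⟩
      obtain ⟨R, hR, Q, hQ, hlt, -⟩ := (hcan C).mp hC
      exact hlt.ne ((hc Q hQ).trans (hc R hR).symm)
    · rw [N.h_of_constant hc k P hPS, WithTop.coe_inj, div_div]
      congr 1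
      rw [show 2 * (k + 1) - 2 = 2 * k by lia]
      ring
    · by_cases h0 : ((E.baseChange (FormalTorsion.LocalClosure 𝔭)).preΨ p).coeff
          ((p ^ 2 - p) / 2) = 0
      · rw [h0, FormalTorsion.val, if_pos rfl]
        exact le_top
      · rw [FormalTorsion.val_of_ne_zero p 𝔭 h0, WithTop.coe_le_coe]
        exact H.le_val_coeff_of_constant hs hψ h2 hcard hc h0
  · obtain ⟨h0, hμ⟩ := H.val_coeff_of_hasBreak hs hψ h2 hcard hB
    have hsum := hB.sum
    have hμβ : 1 - ((p : ℝ) - 1) * α = ((p : ℝ) ^ 2 - p) * β := by linarith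
    set μ := ((p : ℝ) ^ 2 - p) * β with hμdef
    have hβ : μ / ((p : ℝ) ^ 2 - p) = β := by rw [hμdef, mul_div_cancel_left₀ _ hpp.ne']
    have hα : α = (1 - μ) / ((p : ℝ) - 1) := by
      rw [eq_div_iff (by linarith)]
      linarith
    rw [FormalTorsion.val_of_ne_zero p 𝔭 h0, hμ, hμβ]
    have hμ0 : 0 < μ := mul_pos hpp hB.pos
    -- From β < α and (p-1)α + (p^2-p)β = 1 one gets (p^2-1)β < 1.
    have hμlt : μ < p / (p + 1) := by
      rw [lt_div_iff₀ (by linarith)]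
      have : ((p : ℝ) - 1) * β < ((p : ℝ) - 1) * α := mul_lt_mul_of_pos_left hB.lt (by linarith)
      nlinarith
    refine ⟨fun hle ↦ absurd (WithTop.coe_le_coe.mp hle) (not_le.mpr hμlt), fun _ ↦
      ⟨μ, rfl, hμ0, C, ?_⟩⟩
    have hvalj : ∀ {j}, j ≤ k → FormalTorsion.formalVal p 𝔭 E (p ^ j • P) =
        (N.h (p ^ j • P) : WithTop ℝ) := fun {j} hj ↦ by
      refine hval (H.one_lt_norm_xCoord ⟨k + 1, ?_⟩ fun h ↦ hPk ?_)
      · rw [smul_comm, hPn]; exact nsmul_zero _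
      · rw [← Nat.sub_add_cancel hj, pow_add, mul_smul, h]; exact nsmul_zero _
    -- Beyond level k the multiple is the point at infinity, so an index with the finite value β
    -- must satisfy m ≤ k.
    have hvalj' : ∀ {j}, k < j → FormalTorsion.formalVal p 𝔭 E (p ^ j • P) = ⊤ := fun {j} hj ↦ by
      rw [← Nat.sub_add_cancel hj, pow_add, mul_smul, Nat.succ_eq_add_one, hPn]
      exact (congrArg _ (nsmul_zero _)).trans (FormalTorsion.formalVal_zero 𝔭)
    refine ⟨(hcan C).mpr ?_, fun C' hC' ↦ ?_, fun hPC ↦ ?_, fun hPC ↦ ⟨fun hk ↦ ?_, fun hk ↦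
      ⟨fun m hm ↦ ?_, fun hne ↦ ?_⟩⟩⟩
    · obtain ⟨R, hR⟩ := Finset.card_pos.mp (hB.card_mem ▸ Nat.sub_pos_of_lt hp.one_lt)
      obtain ⟨Q, hQ⟩ := Finset.card_pos.mp (hB.card_not_mem ▸ Nat.sub_pos_of_lt
        (lt_self_pow₀ hp.one_lt one_lt_two))
      rw [Finset.mem_filter] at hR hQ
      refine ⟨R, hR.1, Q, hQ.1, ?_, hB.eq_zmultiples R hR.1 hR.2⟩
      change N.h Q < N.h R
      rw [hB.h_mem R hR.1 hR.2, hB.h_not_mem Q hQ.1 hQ.2]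
      exact hB.lt
    · obtain ⟨R, hR, Q, hQ, hlt, rfl⟩ := (hcan C').mp hC'
      change N.h Q < N.h R at hlt
      have hRC : R ∈ C := by
        by_contra hRC
        rw [hB.h_not_mem R hR hRC] at hlt
        by_cases hQC : Q ∈ C
        · rw [hB.h_mem Q hQ hQC] at hlt
          exact hlt.not_gt hB.lt
        · rw [hB.h_not_mem Q hQ hQC] at hlt
          exact hlt.ne rfl
      exact (hB.eq_zmultiples R hR hRC).symm
    · rw [hB.h_of_not_mem hPS hPC, WithTop.coe_inj, show 2 * (k + 1) - 2 = 2 * k by lia,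
        mul_comm ((p : ℝ) ^ (2 * k)), ← div_div, hβ]
    · obtain rfl : k = 0 := by lia
      rw [← hα, WithTop.coe_inj]
      rw [pow_zero, one_smul] at hPS hPC
      exact hB.h_mem P hPS hPC
    · have hmk : m ≤ k := by
        by_contra! h
        have := hm.1
        rw [Set.mem_ofPred_eq, hvalj' h] at this
        exact WithTop.top_ne_coe this
      have hmβ := hm.1
      rw [Set.mem_ofPred_eq, hvalj hmk, WithTop.coe_inj, hβ] at hmβ
      rw [hB.h_of_smul_eq hmk hPS hmβ, WithTop.coe_inj, mul_comm ((p : ℝ) ^ (2 * m)), ← div_div, hβ]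
    · obtain ⟨j, hj⟩ := exists_isLeast_inv_le hp hμ0
      obtain ⟨hsmall, hlarge⟩ := hB.h_of_mem hμdef hj hPS hPC fun m hm h ↦
        hne ⟨m, by rw [hvalj hm, WithTop.coe_inj, h, hβ]⟩
      refine ⟨j, hj, fun hjn ↦ ?_, fun hnj ↦ ?_⟩
      · rw [hlarge (by lia), ← one_sub_pow_div_pow_sub hjn, Nat.add_sub_cancel]
      · obtain ⟨hPval, hcards⟩ := hsmall (by lia)
        obtain ⟨hc1, hc2⟩ := hcards (by lia)
        have hpP : p • P ≠ 0 := fun h ↦ hPk (by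
          rw [← Nat.sub_add_cancel (show 1 ≤ k by lia), pow_succ, mul_smul, h]
          exact nsmul_zero _)
        -- Every R with pR = pP is nonzero p-primary torsion, so lying in the kernel of reduction is
        -- no restriction on the fibre.
        have hset : ∀ c : ℝ, {R : FormalTorsion.GeomPoint 𝔭 E |
            R ∈ FormalTorsion.kernelOfReduction p 𝔭 E ∧ p • R = p • P ∧
            FormalTorsion.formalVal p 𝔭 E R = (c : WithTop ℝ)} =
            {R | p • R = p • P ∧ N.h R = c} := by
          intro c
          ext R
          have hR : p • R = p • P → 1 < FormalTorsion.localAbs 𝔭 (WeierstrassCurve.xCoord R) :=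
            fun h ↦ H.one_lt_norm_xCoord ⟨k + 1, by rw [pow_succ, mul_smul, h, ← mul_smul,
              ← pow_succ, hPn]⟩ fun h0 ↦ hpP (by rw [← h, h0]; exact nsmul_zero _)
          constructor
          · rintro ⟨-, h, hv⟩
            rw [hval (hR h), WithTop.coe_inj] at hv
            exact ⟨h, hv⟩
          · rintro ⟨h, hv⟩
            exact ⟨FormalTorsion.mem_kernelOfReduction 𝔭 h𝔭 hp (hR h), h, by rw [hval (hR h), hv]⟩
        rw [hset, hset, hβ]
        exact ⟨by rw [hPval], by rw [← hPval]; exact hc1, hc2⟩
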